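/- **Mixed tabulation.** Let $c\ge 1$, $d\ge 0$, $b\ge 0$ be integers and let $\Sigma=[2^{b}]=\{0,\dots,2^b-1\}$. A key $x\in[2^{cb}]$ is viewed as a list of $c$ characters $x_0,\dots,x_{c-1}\in\Sigma$, where $x_i$ consists of the $i$th $b$ bits of $x$. A (random) mixed tabulation hash function $[2^{cb}]\to[2^r]$ with $d$ derived characters is given by independent uniformly random tables $T_{1,i}:\Sigma\to\Sigma^d$ ($0\le i<c$) and $T_{2,i}:\Sigma\to[2^r]$ ($0\le i<c+d$): with $\oplus$ denoting bitwise XOR, let $(y_0,\dots,y_{d-1})=\bigoplus_{i<c}T_{1,i}[x_i]$; the hash value of $x$ is $$\bigoplus_{i<c}T_{2,i}[x_i]\ \oplus\ \bigoplus_{i<d}T_{2,c+i}[y_i].$$ **Feature hashing.** For $v\in\mathbb{R}^n$, $h:[n]\to[d']$ and $\operatorname{sgn}:[n]\to\{-1,+1\}$, let $v'\in\mathbb{R}^{d'}$ be defined by $v'_i=\sum_{j:\,h(j)=i}\operatorname{sgn}(j)\,v_j$. **Statement.** For all integers $c\ge1$, $d\ge 0$ and every real $\eta>0$ there is a constant $C>0$,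 depending only on $c,d,\eta$, such that the following holds for all integers $b,\ell\ge 0$ with $|\Sigma|=2^b$ and $d'=2^\ell$. Let $n\le|\Sigma|^c$, let $v\in\mathbb{R}^n$ with $\|v\|_2=1$, and let $\varepsilon,\delta\in(0,1)$. Assume that $$d'\ \ge\ 16\,\varepsilon^{-2}\log_2(1/\delta),\qquad \|v\|_\infty\ \le\ \frac{\sqrt{\varepsilon\ln(1+4/\varepsilon)}}{6\sqrt{\ln(1/\delta)\,\ln(d'/\delta)}},$$ and that $v$ has at most $|\Sigma|/(1+\eta)$ nonzero entries. Then $$\Pr\bigl[\,1-\varepsilon<\|v'\|_2^2<1+\varepsilon\,\bigr]\ \ge\ 1-4\delta-C\,|\Sigma|^{1-\lfloor d/2\rfloor}$$ holds in each of the following two cases: (a) $v'$ is obtained by feature hashing where $h$ and $\operatorname{sgn}$ are given by two independent mixed tabulation hash functions with $d$ derived characters over $\Sigma$, with values in $[d']$ and in $[2]\cong\{-1,+1\}$ respectively; (b) $h$ and $\operatorname{sgn}$ are the two components of a single mixed tabulation hash function $h^\star:[n]\to\{-1,+1\}\times[d']$ with $d$ derived characters over $\Sigma$ (one bit of a hash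 value in $[2d']$ giving the sign and the other bits giving the bucket). -/

import Mathlib

/-- Bit strings of length `b`, i.e. the elements of `[2 ^ b]` written in binary.
The pointwise addition of `ZMod 2` is the bitwise XOR. -/
abbrev Bits (b : ℕ) : Type := Fin b → ZMod 2

/-- The `i`-th character `x_i` of the key `x`: the bits `i * b, …, i * b + b - 1` of `x`. -/
def keyChar (b : ℕ) (x i : ℕ) : Bits b :=
  fun t => if x.testBit (i * b + t) then 1 else 0

/-- The tables of a mixed tabulation hash function with `c` input characters and `d` derived
characters from the alphabet `Σ = [2 ^ b]` and with `r`-bit hash values: `c` tables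
`T₁ i : Σ → Σ ^ d` and `c + d` tables `T₂ i : Σ → [2 ^ r]`. -/
abbrev MixedTables (c d b r : ℕ) : Type :=
  (Fin c → Bits b → Fin d → Bits b) × (Fin (c + d) → Bits b → Bits r)

instance finite_mixedTables (c d b r : ℕ) : Finite (MixedTables c d b r) := inferInstance

/-- The vector of the `d` derived characters of the key `x`: the XOR of the entries
`T₁ i [x_i]`. -/
def derivedChars {c d b r : ℕ} (T : MixedTables c d b r) (x : ℕ) : Fin d → Bits b :=
  ∑ i : Fin c, T.1 i (keyChar b x i)

/-- The mixed tabulation hash value of the key `x` under the tables `T`. -/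
def mixedTabulation {c d b r : ℕ} (T : MixedTables c d b r) (x : ℕ) : Bits r :=
  (∑ i : Fin c, T.2 (Fin.castAdd d i) (keyChar b x i)) +
    ∑ i : Fin d, T.2 (Fin.natAdd c i) (derivedChars T x i)

/-- A bit read as a sign in `{-1, +1}`. -/
def bitSign (z : ZMod 2) : ℤˣ := if z = 0 then 1 else -1

/-- Feature hashing: `v'_i` is the sum of `sgn j * v_j` over all `j` with `h j = i`. -/
noncomputable def featureHash {D B : Type} [Fintype D] [DecidableEq B]
    (h : D → B) (sgn : D → ℤˣ) (v : EuclideanSpace ℝ D) : EuclideanSpace ℝ B :=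
  WithLp.toLp 2 fun i => ∑ j : D with h j = i, ((sgn j : ℤ) : ℝ) * v j

/-- Feature hashing into dimension `2 ^ l`, where `h` is given by mixed tabulation with the
tables `T` and the sign function by one-bit mixed tabulation with the tables `S`. -/
noncomputable def fhTwo {c d b l n : ℕ} (T : MixedTables c d b l) (S : MixedTables c d b 1)
    (v : EuclideanSpace ℝ (Fin n)) : EuclideanSpace ℝ (Bits l) :=
  featureHash (fun j : Fin n => mixedTabulation T j) (fun j => bitSign (mixedTabulation S j 0)) v

/-- Feature hashing into dimension `2 ^ l`, where a single mixed tabulation function with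
`(l + 1)`-bit values supplies both the sign (first bit) and the bucket (other `l` bits). -/
noncomputable def fhOne {c d b l n : ℕ} (T : MixedTables c d b (l + 1))
    (v : EuclideanSpace ℝ (Fin n)) : EuclideanSpace ℝ (Bits l) :=
  featureHash (fun j : Fin n => Fin.tail (mixedTabulation T j))
    (fun j => bitSign (mixedTabulation T j 0)) v

/-- Probability of the event `E` under the uniform distribution on the finite type `Ω`. -/
noncomputable def uniformProb {Ω : Type} (E : Set Ω) : ℝ :=
  (E.ncard : ℝ) / (Nat.card Ω : ℝ)

/-!
The theorem combines a tail bound for feature hashing with truly random functions and the fact that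
mixed tabulation is, with high probability over the tables `T₁` of the derived characters, truly
random on a given set of at most `2 ^ b / (1 + η)` keys; only the keys in the support of `v` matter.

*Truly random functions.* The keys are hashed one after the other. Adding the entry `x` to the
bucket sums `S` changes the squared norm `N` by `± 2 x S_i + x²` for a random bucket `i`, so as
long as all bucket sums are at most `B`, the mean of `exp (θ N)` grows by at most the factor
`exp (θ x² + q x² N)`: the exponent `θ` drifts by `q x²` (`sum_exp_sq_norm_le`). Since the total
mass of `v` is `1`, the drift is harmless, and Markov's inequality bounds both tails by `δ`. The
potential `∑ i, cosh (μ S_i)` shows that a bucket sum ever exceeds `B` with probability at most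
`2 δ` (`sum_not_staysBounded_le`).

*Mixed tabulation.* The hash values of a set of keys are independent and uniform as soon as the
indicator vectors of the extended keys are linearly independent over `𝔽₂`
(`tableSum_surjective`). A dependency yields a set `Y` of keys in which every derived character of
every key is shared with another key of `Y` (`linearIndependent_extendedKey`). Derived characters
are grouped into `⌊d / 2⌋` independent pairs of simple tabulation functions, and `Y` lies in the
core of each pair. The expected size of the core of one pair on `n` keys is `O(n / 2 ^ b)`, so some
key is in the core with probability `O(1 / 2 ^ b)`, hence in all cores with probability
`O(1 / 2 ^ b) ^ ⌊d / 2⌋`; removing such keys one by one gives the claim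
(`uniformProb_hasCommonCore_le`).

*The size of the core.* From a key of the core one walks inside the core, alternately along
coincidences of the two functions, until the current key has no character that is new on the walk.
The coincidences before the last step are independent, since each involves a new character. If the
last one is independent of them too, then a walk with `w + 1` steps has probability
`2 ^ (-b (w + 1))`, and there are at most `n ^ (w + 1) (w + 1) ^ c` such walks. If it is implied by
them, one factor `2 ^ (-b)` is lost, but then two steps of the walk cancel outside of the
characters of the other keys (`IsClosing.exists_cancels`), which leaves only
`n ^ w` walks up to a polynomial in `w`, by a tensorized Cauchy–Schwarz inequality for quadruples
of keys (`card_quadruples_le`). As `n / 2 ^ b ≤ 1 / (1 + η)`, the sum over `w` converges.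
-/

/-! ### Feature hashing with truly random functions -/

section RandomFeatureHashing

variable {β : Type} [Fintype β] [DecidableEq β]

/-- The real number `±1` encoded by a bit. -/
noncomputable def signVal (z : ZMod 2) : ℝ := ((bitSign z : ℤ) : ℝ)

/-- The bucket sums `S` after a key with entry `x` has been hashed to the bucket `p.1` with the
sign bit `p.2`. -/
noncomputable def addKey (S : β → ℝ) (p : β × ZMod 2) (x : ℝ) : β → ℝ :=
  fun i => S i + if p.1 = i then signVal p.2 * x else 0

/-- The bucket sums after all keys have been hashed, starting from the bucket sums `S`. -/
noncomputable def bucketSums {κ : Type} [Fintype κ] (v : κ → ℝ) (ω : κ → β × ZMod 2)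
    (S : β → ℝ) : β → ℝ :=
  fun i => S i + ∑ j, if (ω j).1 = i then signVal (ω j).2 * v j else 0

/-- When the keys are hashed one after the other, starting from the bucket sums `S`, every bucket
sum has absolute value at most `B` just before each of the keys is hashed. -/
def StaysBounded (B : ℝ) : (n : ℕ) → (Fin n → ℝ) → (Fin n → β × ZMod 2) → (β → ℝ) → Prop
  | 0, _, _, _ => True
  | n + 1, v, ω, S =>
      (∀ i, |S i| ≤ B) ∧ StaysBounded B n (Fin.tail v) (Fin.tail ω) (addKey S (ω 0) (v 0))

lemma signVal_zero : signVal 0 = 1 := by simp [signVal, bitSign]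

lemma signVal_one : signVal 1 = -1 := by simp [signVal, bitSign]

lemma sum_zmod_two (F : ZMod 2 → ℝ) : ∑ z, F z = F 0 + F 1 := Fin.sum_univ_two F

omit [Fintype β] in
lemma bucketSums_succ {n : ℕ} (v : Fin (n + 1) → ℝ) (ω : Fin (n + 1) → β × ZMod 2) (S : β → ℝ) :
    bucketSums v ω S = bucketSums (Fin.tail v) (Fin.tail ω) (addKey S (ω 0) (v 0)) := by
  funext i
  simp only [bucketSums, addKey, Fin.sum_univ_succ, Fin.tail, add_assoc]
  rfl

lemma sum_fin_succ_fun {α : Type} [Fintype α] {n : ℕ} (F : (Fin (n + 1) → α) → ℝ) :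
    ∑ ω, F ω = ∑ p : α, ∑ ω : Fin n → α, F (Fin.cons p ω) := by
  rw [← (Fin.consEquiv fun _ => α).sum_comp, Fintype.sum_prod_type]
  rfl

lemma sum_cosh_addKey (S : β → ℝ) (x μ : ℝ) (i : β) :
    ∑ p : β × ZMod 2, Real.cosh (μ * addKey S p x i) =
      2 * Real.cosh (μ * S i) * (Fintype.card β + (Real.cosh (μ * x) - 1)) := by
  rw [Fintype.sum_prod_type]
  simp only [sum_zmod_two, addKey, signVal_zero, signVal_one]
  have h : ∀ j : β, Real.cosh (μ * (S i + if j = i then 1 * x else 0)) +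
      Real.cosh (μ * (S i + if j = i then -1 * x else 0)) =
      2 * Real.cosh (μ * S i) +
        if j = i then 2 * Real.cosh (μ * S i) * (Real.cosh (μ * x) - 1) else 0 := by
    intro j
    split_ifs
    · have e1 : μ * (S i + 1 * x) = μ * S i + μ * x := by ring
      have e2 : μ * (S i + -1 * x) = μ * S i - μ * x := by ring
      rw [e1, e2, Real.cosh_add, Real.cosh_sub]; ring
    · simp only [add_zero]; ring
  simp only [h, Finset.sum_add_distrib, Finset.sum_const, Finset.card_univ, nsmul_eq_mul,
    Finset.sum_ite_eq', Finset.mem_univ, if_true]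
  ring

/-- The probability that some bucket sum leaves `[-B, B]`. The potential `∑ i, 2 cosh (μ S_i)`
grows in expectation by at most the factor `exp (γ x² / m)` when an entry `x` is added, and it is
at least `exp (μ B)` once a bucket sum has left the interval. -/
lemma sum_not_staysBounded_le [Nonempty β] (a B μ γ : ℝ) (hμ : 0 ≤ μ) (hγ : 0 ≤ γ)
    (hcosh : ∀ x, |x| ≤ a → Real.cosh (μ * x) - 1 ≤ γ * x ^ 2) :
    ∀ (n : ℕ) (v : Fin n → ℝ) (S : β → ℝ), (∀ j, |v j| ≤ a) →
      ∑ ω : Fin n → β × ZMod 2, (open Classical in if StaysBounded B n v ω S then (0 : ℝ) else 1) ≤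
        (2 * Fintype.card β : ℝ) ^ n *
          (Real.exp (-(μ * B) + γ * (∑ j, v j ^ 2) / Fintype.card β) *
            ∑ i, 2 * Real.cosh (μ * S i)) := by
  classical
  have hm : (0 : ℝ) < Fintype.card β := by exact_mod_cast Fintype.card_pos
  intro n
  induction n with
  | zero =>
    intro v S _
    have h0 : ∑ ω : Fin 0 → β × ZMod 2,
        (if StaysBounded B 0 v ω S then (0 : ℝ) else 1) = 0 := by
      simp [StaysBounded]
    rw [h0]
    have : ∀ i, 0 < Real.cosh (μ * S i) := fun i => Real.cosh_pos _
    have h2 : 0 ≤ ∑ i, 2 * Real.cosh (μ * S i) :=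
      Finset.sum_nonneg fun i _ => by linarith [this i]
    positivity
  | succ n ih =>
    intro v S hv
    by_cases hS : ∀ i, |S i| ≤ B
    · rw [sum_fin_succ_fun]
      have hW : ∑ j, v j ^ 2 = v 0 ^ 2 + ∑ j, Fin.tail v j ^ 2 := by
        rw [Fin.sum_univ_succ]; rfl
      set W := ∑ j, Fin.tail v j ^ 2 with hWd
      set E := Real.exp (-(μ * B) + γ * W / Fintype.card β) with hE
      have hE0 : 0 < E := Real.exp_pos _
      have step : ∀ p : β × ZMod 2,
          ∑ ω : Fin n → β × ZMod 2,
            (if StaysBounded B (n + 1) v (Fin.cons p ω) S then (0 : ℝ) else 1) ≤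
          (2 * Fintype.card β : ℝ) ^ n * (E * ∑ i, 2 * Real.cosh (μ * addKey S p (v 0) i)) := by
        intro p
        have := ih (Fin.tail v) (addKey S p (v 0)) (fun j => hv _)
        simpa [StaysBounded, hS] using this
      refine (Finset.sum_le_sum fun p _ => step p).trans ?_
      rw [← Finset.mul_sum, ← Finset.mul_sum, Finset.sum_comm]
      simp only [← Finset.mul_sum]
      simp only [sum_cosh_addKey]
      have hexp : (1 : ℝ) + (Real.cosh (μ * v 0) - 1) / Fintype.card β ≤
          Real.exp (γ * v 0 ^ 2 / Fintype.card β) := by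
        have h1 := Real.add_one_le_exp (γ * v 0 ^ 2 / Fintype.card β)
        have h2 : (Real.cosh (μ * v 0) - 1) / Fintype.card β ≤ γ * v 0 ^ 2 / Fintype.card β := by
          gcongr; exact hcosh _ (hv 0)
        linarith
      have hE2 : Real.exp (-(μ * B) + γ * (∑ j, v j ^ 2) / Fintype.card β) =
          E * Real.exp (γ * v 0 ^ 2 / Fintype.card β) := by
        rw [hE, ← Real.exp_add, hW]; congr 1; ring
      rw [hE2, pow_succ]
      simp only [Finset.mul_sum]
      refine Finset.sum_le_sum fun i _ => ?_
      have hc : 0 < Real.cosh (μ * S i) := Real.cosh_pos _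
      have e1 : (Fintype.card β : ℝ) + (Real.cosh (μ * v 0) - 1) =
          Fintype.card β * (1 + (Real.cosh (μ * v 0) - 1) / Fintype.card β) := by
        field_simp
      rw [e1]
      calc _ = (2 * Fintype.card β : ℝ) ^ n * (2 * Fintype.card β) * (E *
              (1 + (Real.cosh (μ * v 0) - 1) / Fintype.card β) * (2 * Real.cosh (μ * S i))) := by
            ring
        _ ≤ (2 * Fintype.card β : ℝ) ^ n * (2 * Fintype.card β) * (E *
              Real.exp (γ * v 0 ^ 2 / Fintype.card β) * (2 * Real.cosh (μ * S i))) := by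
            gcongr
        _ = _ := by ring
    · have h0 : ∀ ω : Fin (n + 1) → β × ZMod 2, ¬ StaysBounded B (n + 1) v ω S :=
        fun ω h => hS h.1
      simp only [h0, if_false, Finset.sum_const, Finset.card_univ, Fintype.card_fun,
        Fintype.card_prod, ZMod.card, Fintype.card_fin, nsmul_eq_mul, mul_one]
      push Not at hS
      obtain ⟨i, hi⟩ := hS
      have h1 : Real.exp (μ * B) ≤ 2 * Real.cosh (μ * S i) := by
        rw [← Real.cosh_abs, abs_mul, abs_of_nonneg hμ, Real.cosh_eq]
        have : Real.exp (μ * B) ≤ Real.exp (μ * |S i|) := by gcongr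
        have := Real.exp_pos (-(μ * |S i|))
        linarith
      have h2 : 2 * Real.cosh (μ * S i) ≤ ∑ i, 2 * Real.cosh (μ * S i) :=
        Finset.single_le_sum (f := fun i => 2 * Real.cosh (μ * S i))
          (fun i _ => by have := Real.cosh_pos (μ * S i); positivity) (Finset.mem_univ i)
      have h3 : Real.exp (-(μ * B)) ≤
          Real.exp (-(μ * B) + γ * (∑ j, v j ^ 2) / Fintype.card β) := by
        gcongr
        have : 0 ≤ ∑ j, v j ^ 2 := Finset.sum_nonneg fun j _ => sq_nonneg _
        have : 0 ≤ γ * (∑ j, v j ^ 2) / Fintype.card β := by positivity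
        linarith
      have h4 : 1 ≤ Real.exp (-(μ * B) + γ * (∑ j, v j ^ 2) / Fintype.card β) *
            ∑ i, 2 * Real.cosh (μ * S i) := by
        calc (1 : ℝ) = Real.exp (-(μ * B)) * Real.exp (μ * B) := by
              rw [← Real.exp_add]; simp
          _ ≤ _ := by gcongr; exact h1.trans h2
      have h5 : (((Fintype.card β * 2 : ℕ) ^ (n + 1) : ℕ) : ℝ) =
          (2 * Fintype.card β : ℝ) ^ (n + 1) := by
        push_cast; ring
      rw [h5]
      exact le_mul_of_one_le_right (by positivity) h4

lemma sum_sq_addKey (S : β → ℝ) (i : β) (z : ZMod 2) (x : ℝ) :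
    ∑ k, addKey S (i, z) x k ^ 2 = ∑ k, S k ^ 2 + 2 * (signVal z * x) * S i + x ^ 2 := by
  have hs : signVal z ^ 2 = 1 := by
    unfold signVal bitSign; split_ifs <;> simp
  have h : ∀ k, addKey S (i, z) x k ^ 2 =
      S k ^ 2 + if i = k then 2 * (signVal z * x) * S k + x ^ 2 else 0 := by
    intro k
    simp only [addKey]
    split_ifs
    · linear_combination x ^ 2 * hs
    · ring
  simp only [h, Finset.sum_add_distrib, Finset.sum_ite_eq, Finset.mem_univ, if_true]
  ring

lemma cosh_le_one_add {y : ℝ} (hy : |y| ≤ 7 / 10) : Real.cosh y ≤ 1 + 5 / 8 * y ^ 2 := by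
  have h1 := Real.cosh_le_exp_half_sq y
  have hy2 : y ^ 2 ≤ 49 / 100 := by
    rw [← sq_abs]; nlinarith [abs_nonneg y]
  have h2 := Real.abs_exp_sub_one_sub_id_le (x := y ^ 2 / 2)
    (by rw [abs_of_nonneg (by positivity)]; linarith)
  have h3 := (abs_le.1 h2).2
  nlinarith [sq_nonneg y]

/-- The moment generating function of the squared norm, restricted to the event that the bucket
sums stay bounded. Adding an entry `x` to bucket sums of squared norm `N` multiplies
`exp (θ N)` in expectation by `exp (θ x²)` times the mean of `cosh (2 θ x S_i)` over the buckets,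
which is at most `exp (q x² N)`; so `θ` is replaced by `θ + q x²`. -/
lemma sum_exp_sq_norm_le [Nonempty β] (a B K q : ℝ)
    (hq : q = 5 / 2 * K ^ 2 / Fintype.card β) (hKB : 2 * K * a * B ≤ 7 / 10) :
    ∀ (n : ℕ) (v : Fin n → ℝ) (S : β → ℝ) (θ : ℝ), (∀ j, |v j| ≤ a) →
      |θ| + q * ∑ j, v j ^ 2 ≤ K →
      ∑ ω : Fin n → β × ZMod 2, (open Classical in if StaysBounded B n v ω S then
          Real.exp (θ * ∑ i, bucketSums v ω S i ^ 2) else 0) ≤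
        (2 * Fintype.card β : ℝ) ^ n *
          Real.exp ((θ + q * ∑ j, v j ^ 2) * (∑ i, S i ^ 2 + ∑ j, v j ^ 2)) := by
  classical
  have hm : (0 : ℝ) < Fintype.card β := by exact_mod_cast Fintype.card_pos
  have hq0 : 0 ≤ q := by rw [hq]; positivity
  intro n
  induction n with
  | zero =>
    intro v S θ _ _
    simp [StaysBounded, bucketSums]
  | succ n ih =>
    intro v S θ hv hθ
    have hW : ∑ j, v j ^ 2 = v 0 ^ 2 + ∑ j, Fin.tail v j ^ 2 := by
      rw [Fin.sum_univ_succ]; rfl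
    have hW0 : 0 ≤ ∑ j, Fin.tail v j ^ 2 := Finset.sum_nonneg fun j _ => sq_nonneg _
    have hN0 : 0 ≤ ∑ i, S i ^ 2 := Finset.sum_nonneg fun j _ => sq_nonneg _
    rw [hW] at hθ ⊢
    set W := ∑ j, Fin.tail v j ^ 2 with hWd
    set N := ∑ i, S i ^ 2 with hN
    by_cases hS : ∀ i, |S i| ≤ B
    · rw [sum_fin_succ_fun]
      have hx0 : 0 ≤ q * v 0 ^ 2 := by positivity
      have hqW : 0 ≤ q * W := by positivity
      have hθ' : |θ + q * W| ≤ K := by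
        calc |θ + q * W| ≤ |θ| + |q * W| := abs_add_le _ _
          _ = |θ| + q * W := by rw [abs_of_nonneg hqW]
          _ ≤ K := by linarith
      set φ := θ + q * W with hφ
      have step : ∀ p : β × ZMod 2,
          ∑ ω : Fin n → β × ZMod 2,
            (if StaysBounded B (n + 1) v (Fin.cons p ω) S then
              Real.exp (θ * ∑ i, bucketSums v (Fin.cons p ω) S i ^ 2) else 0) ≤
          (2 * Fintype.card β : ℝ) ^ n *
            Real.exp (φ * (∑ i, addKey S p (v 0) i ^ 2 + W)) := by
        intro p
        have := ih (Fin.tail v) (addKey S p (v 0)) θ (fun j => hv _) (by linarith)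
        simpa [StaysBounded, hS, bucketSums_succ] using this
      refine (Finset.sum_le_sum fun p _ => step p).trans ?_
      rw [← Finset.mul_sum, Fintype.sum_prod_type, pow_succ, mul_assoc]
      gcongr
      simp only [sum_zmod_two, sum_sq_addKey, signVal_zero, signVal_one]
      have hbound : ∀ i : β,
          Real.exp (φ * (N + 2 * (1 * v 0) * S i + v 0 ^ 2 + W)) +
            Real.exp (φ * (N + 2 * (-1 * v 0) * S i + v 0 ^ 2 + W)) ≤
          Real.exp (φ * (N + (v 0 ^ 2 + W))) *
            (2 * (1 + 5 / 2 * K ^ 2 * v 0 ^ 2 * S i ^ 2)) := by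
        intro i
        have e1 : φ * (N + 2 * (1 * v 0) * S i + v 0 ^ 2 + W) =
            φ * (N + (v 0 ^ 2 + W)) + 2 * φ * v 0 * S i := by ring
        have e2 : φ * (N + 2 * (-1 * v 0) * S i + v 0 ^ 2 + W) =
            φ * (N + (v 0 ^ 2 + W)) + -(2 * φ * v 0 * S i) := by ring
        rw [e1, e2, Real.exp_add, Real.exp_add, ← mul_add]
        gcongr
        have hK0 : 0 ≤ K := (abs_nonneg _).trans hθ'
        have ha0 : 0 ≤ a := (abs_nonneg _).trans (hv 0)
        have hy : |2 * φ * v 0 * S i| ≤ 7 / 10 := by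
          rw [abs_mul, abs_mul, abs_mul, abs_two]
          refine le_trans ?_ hKB
          gcongr
          · exact hv 0
          · exact hS i
        have hc := cosh_le_one_add hy
        rw [Real.cosh_eq] at hc
        have h3 : (2 * φ * v 0 * S i) ^ 2 ≤ 4 * (K ^ 2 * v 0 ^ 2 * S i ^ 2) := by
          have : φ ^ 2 ≤ K ^ 2 := by
            rw [← sq_abs φ]; gcongr
          calc (2 * φ * v 0 * S i) ^ 2 = 4 * (φ ^ 2 * v 0 ^ 2 * S i ^ 2) := by ring
            _ ≤ _ := by gcongr
        linarith
      refine (Finset.sum_le_sum fun i _ => hbound i).trans ?_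
      rw [← Finset.mul_sum, ← Finset.mul_sum, Finset.sum_add_distrib, ← Finset.mul_sum]
      simp only [Finset.sum_const, Finset.card_univ, nsmul_eq_mul, mul_one, ← hN]
      have h1 : (Fintype.card β : ℝ) + 5 / 2 * K ^ 2 * v 0 ^ 2 * N =
          Fintype.card β * (1 + q * v 0 ^ 2 * N) := by
        rw [hq]; field_simp
      have h2 : 1 + q * v 0 ^ 2 * N ≤ Real.exp (q * v 0 ^ 2 * (N + (v 0 ^ 2 + W))) := by
        have h3 := Real.add_one_le_exp (q * v 0 ^ 2 * (N + (v 0 ^ 2 + W)))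
        have h4 : q * v 0 ^ 2 * N ≤ q * v 0 ^ 2 * (N + (v 0 ^ 2 + W)) := by
          gcongr; nlinarith [sq_nonneg (v 0)]
        linarith
      have h5 : Real.exp ((θ + q * (v 0 ^ 2 + W)) * (N + (v 0 ^ 2 + W))) =
          Real.exp (φ * (N + (v 0 ^ 2 + W))) * Real.exp (q * v 0 ^ 2 * (N + (v 0 ^ 2 + W))) := by
        rw [← Real.exp_add, hφ]; congr 1; ring
      rw [h1, h5]
      calc _ = 2 * (Fintype.card β : ℝ) * (Real.exp (φ * (N + (v 0 ^ 2 + W))) *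
              (1 + q * v 0 ^ 2 * N)) := by ring
        _ ≤ _ := by gcongr
    · have h0 : ∀ ω : Fin (n + 1) → β × ZMod 2, ¬ StaysBounded B (n + 1) v ω S :=
        fun ω h => hS h.1
      simp only [h0, if_false, Finset.sum_const_zero]
      positivity

end RandomFeatureHashing

/-! ### Uniform probabilities -/

section UniformProb

variable {Ω Ω' : Type}

lemma uniformProb_eq_sum_div [Fintype Ω] (E : Set Ω) :
    uniformProb E = (∑ ω, (open Classical in if ω ∈ E then (1 : ℝ) else 0)) / Fintype.card Ω := by
  classical
  rw [uniformProb, Nat.card_eq_fintype_card, Set.ncard_eq_toFinset_card', Finset.sum_boole]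
  congr 3
  ext ω
  simp

/-- Markov's inequality. -/
lemma uniformProb_le_sum_div [Fintype Ω] {E : Set Ω} {F : Ω → ℝ} (h0 : ∀ ω, 0 ≤ F ω)
    (h1 : ∀ ω ∈ E, 1 ≤ F ω) :
    uniformProb E ≤ (∑ ω, F ω) / Fintype.card Ω := by
  rw [uniformProb_eq_sum_div]
  gcongr with ω _
  split_ifs with h
  · exact h1 ω h
  · exact h0 ω

lemma uniformProb_nonneg (E : Set Ω) : 0 ≤ uniformProb E := by
  unfold uniformProb; positivity

lemma uniformProb_mono [Finite Ω] {E F : Set Ω} (h : E ⊆ F) : uniformProb E ≤ uniformProb F := by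
  unfold uniformProb
  have := Set.ncard_le_ncard h (Set.toFinite F)
  gcongr

lemma uniformProb_union_le (E F : Set Ω) :
    uniformProb (E ∪ F) ≤ uniformProb E + uniformProb F := by
  unfold uniformProb
  rw [← add_div]
  have := Set.ncard_union_le E F
  gcongr
  exact_mod_cast this

lemma uniformProb_empty : uniformProb (∅ : Set Ω) = 0 := by simp [uniformProb]

lemma uniformProb_biUnion_le {ι : Type} (s : Finset ι) (E : ι → Set Ω) :
    uniformProb (⋃ i ∈ s, E i) ≤ ∑ i ∈ s, uniformProb (E i) := by
  classical
  induction s using Finset.induction_on with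
  | empty => simp [uniformProb_empty]
  | insert i s hi ih =>
    rw [Finset.set_biUnion_insert, Finset.sum_insert hi]
    exact (uniformProb_union_le _ _).trans (by gcongr)

lemma uniformProb_compl [Finite Ω] [Nonempty Ω] (E : Set Ω) : uniformProb Eᶜ = 1 - uniformProb E := by
  unfold uniformProb
  have h := Set.ncard_add_ncard_compl E
  have h2 : ((E.ncard : ℝ) + (Eᶜ.ncard : ℝ)) = Nat.card Ω := by exact_mod_cast h
  have h3 : (Nat.card Ω : ℝ) ≠ 0 := by
    exact_mod_cast Nat.card_pos.ne'
  field_simp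
  linarith

lemma uniformProb_le_one [Finite Ω] (E : Set Ω) : uniformProb E ≤ 1 := by
  unfold uniformProb
  apply div_le_one_of_le₀ _ (by positivity)
  exact_mod_cast Set.ncard_le_card E

/-- A surjective additive map between finite groups takes the uniform distribution to the uniform
distribution. -/
lemma uniformProb_preimage_of_surjective [Finite Ω] [Finite Ω']
    [AddCommGroup Ω] [AddCommGroup Ω']
    (f : Ω → Ω') (hadd : ∀ x y, f (x + y) = f x + f y) (hf : Function.Surjective f) (E : Set Ω') :
    uniformProb (f ⁻¹' E) = uniformProb E := by
  classical
  cases nonempty_fintype Ω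
  cases nonempty_fintype Ω'
  let φ : Ω →+ Ω' := ⟨⟨f, by simpa using hadd 0 0⟩, hadd⟩
  have hfib : ∀ y, (Finset.univ.filter fun x => f x = y).card =
      (Finset.univ.filter fun x => f x = 0).card := by
    intro y
    obtain ⟨x₀, rfl⟩ := hf y
    refine Finset.card_bij' (fun x _ => x - x₀) (fun x _ => x + x₀) ?_ ?_ ?_ ?_
    · intro x hx
      have hx' : φ x = φ x₀ := (Finset.mem_filter.1 hx).2
      exact Finset.mem_filter.2 ⟨Finset.mem_univ _, show φ (x - x₀) = 0 by simp [hx']⟩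
    · intro x hx
      have hx' : φ x = 0 := (Finset.mem_filter.1 hx).2
      exact Finset.mem_filter.2 ⟨Finset.mem_univ _, show φ (x + x₀) = φ x₀ by simp [hx']⟩
    · simp
    · simp
  set k := (Finset.univ.filter fun x => f x = 0).card with hk
  have hk0 : 0 < k := by
    rw [hk, Finset.card_pos]
    exact ⟨0, Finset.mem_filter.2 ⟨Finset.mem_univ _, map_zero φ⟩⟩
  have hcount : ∀ F : Finset Ω', (Finset.univ.filter fun x => f x ∈ F).card = F.card * k := by
    intro F
    rw [Finset.card_eq_sum_card_fiberwise (f := f) (t := F) (fun x hx => by simpa using hx),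
      Finset.sum_const_nat]
    intro y hy
    rw [← hfib y, Finset.filter_filter]
    congr 1
    ext x
    simp only [Finset.mem_filter, Finset.mem_univ, true_and]
    constructor
    · exact fun h => h.2
    · exact fun h => ⟨h ▸ hy, h⟩
  have h1 : (f ⁻¹' E).ncard = E.ncard * k := by
    rw [Set.ncard_eq_toFinset_card', Set.ncard_eq_toFinset_card', ← hcount]
    congr 1
    ext; simp
  have h2 : Fintype.card Ω = Fintype.card Ω' * k := by
    have := hcount Finset.univ
    simpa using this
  unfold uniformProb
  rw [Nat.card_eq_fintype_card, Nat.card_eq_fintype_card, h1, h2]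
  push_cast
  have : (k : ℝ) ≠ 0 := by exact_mod_cast hk0.ne'
  exact mul_div_mul_right _ _ this

lemma uniformProb_preimage_equiv (e : Ω ≃ Ω') (E : Set Ω') :
    uniformProb (e ⁻¹' E) = uniformProb E := by
  unfold uniformProb
  rw [Nat.card_congr e]
  congr 2
  rw [← Set.ncard_image_of_injective _ e.injective, Set.image_preimage_eq _ e.surjective]

/-- Conditioning on the first component: outside of the event `F` the conditional probability of
`E` is at most `p`. -/
lemma uniformProb_prod_le [Finite Ω] [Finite Ω'] [Nonempty Ω] [Nonempty Ω']
    (E : Set (Ω × Ω')) (F : Set Ω) (p : ℝ)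
    (hp : 0 ≤ p) (h : ∀ ω ∉ F, uniformProb {ω' : Ω' | (ω, ω') ∈ E} ≤ p) :
    uniformProb E ≤ uniformProb F + p := by
  classical
  cases nonempty_fintype Ω
  cases nonempty_fintype Ω'
  have h1 : (0 : ℝ) < Fintype.card Ω := by exact_mod_cast Fintype.card_pos
  have h2 : (0 : ℝ) < Fintype.card Ω' := by exact_mod_cast Fintype.card_pos
  have h3 : ∀ ω, (∑ ω' : Ω', if (ω, ω') ∈ E then (1 : ℝ) else 0) / Fintype.card Ω' ≤
      (if ω ∈ F then (1 : ℝ) else 0) + p := by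
    intro ω
    have h4 := uniformProb_eq_sum_div {ω' : Ω' | (ω, ω') ∈ E}
    simp only [Set.mem_ofPred_eq] at h4
    rw [← h4]
    split_ifs with hω
    · linarith [uniformProb_le_one {ω' : Ω' | (ω, ω') ∈ E}]
    · linarith [h ω hω]
  rw [uniformProb_eq_sum_div, uniformProb_eq_sum_div, Fintype.sum_prod_type, Fintype.card_prod,
    Nat.cast_mul, ← div_div, div_right_comm, Finset.sum_div]
  calc _ ≤ (∑ ω : Ω, ((if ω ∈ F then (1 : ℝ) else 0) + p)) / Fintype.card Ω := by
        gcongr with ω _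
        exact h3 ω
    _ = _ := by
        rw [Finset.sum_add_distrib, add_div]
        simp only [Finset.sum_const, Finset.card_univ, nsmul_eq_mul]
        field_simp

lemma uniformProb_pi [Finite Ω] {ι : Type} [Fintype ι] {E : ι → Set Ω} :
    uniformProb {ω : ι → Ω | ∀ i, ω i ∈ E i} = ∏ i, uniformProb (E i) := by
  classical
  cases nonempty_fintype Ω
  unfold uniformProb
  have h : ({ω : ι → Ω | ∀ i, ω i ∈ E i}).ncard = ∏ i, (E i).ncard := by
    rw [Set.ncard_eq_toFinset_card']
    have : ({ω : ι → Ω | ∀ i, ω i ∈ E i}).toFinset = Fintype.piFinset fun i => (E i).toFinset := by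
      ext; simp
    rw [this, Fintype.card_piFinset]
    simp only [Set.ncard_eq_toFinset_card']
  rw [h, Nat.card_fun]
  simp [Finset.prod_div_distrib]

end UniformProb

/-! ### The tail bound for truly random functions -/

section RandomFeatureHashingTail

variable {β : Type} [Fintype β] [DecidableEq β]

lemma cosh_sub_one_le {y Y : ℝ} (hY : 0 < Y) (h : |y| ≤ Y) :
    Real.cosh y - 1 ≤ (y / Y) ^ 2 * (Real.cosh Y - 1) := by
  have h1 := (hasSum_nat_add_iff' 1).2 (Real.hasSum_cosh y)
  have h2 := ((hasSum_nat_add_iff' 1).2 (Real.hasSum_cosh Y)).mul_left ((y / Y) ^ 2)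
  simp only [Finset.sum_range_one, mul_zero, pow_zero, Nat.factorial_zero, Nat.cast_one,
    div_one] at h1 h2
  refine hasSum_le (fun n => ?_) h1 h2
  have hr : (y / Y) ^ 2 ≤ 1 := by
    rw [div_pow, div_le_one (by positivity), ← sq_abs y]
    gcongr
  have e : y ^ (2 * (n + 1)) = (y / Y) ^ 2 * ((y / Y) ^ 2) ^ n * Y ^ (2 * (n + 1)) := by
    rw [← pow_succ', ← pow_mul, mul_comm (n + 1) 2 |>.symm, mul_comm (n + 1) 2, div_pow,
      div_mul_cancel₀ _ (by positivity)]
  rw [e, mul_div_assoc]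
  have h0 : 0 ≤ Y ^ (2 * (n + 1)) / ((2 * (n + 1)).factorial : ℝ) := by positivity
  have h3 : ((y / Y) ^ 2) ^ n ≤ 1 := pow_le_one₀ (by positivity) hr
  have h4 : (y / Y) ^ 2 * ((y / Y) ^ 2) ^ n ≤ (y / Y) ^ 2 :=
    mul_le_of_le_one_right (by positivity) h3
  gcongr

/-- Feature hashing with truly random functions preserves the norm of a unit vector with small
entries up to a factor `1 ± ε`, except with probability `4 δ`. -/
lemma uniformProb_fin_featureHashing_le [Nonempty β] {n : ℕ} (v : Fin n → ℝ) (ε δ : ℝ)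
    (hε : 0 < ε) (hε1 : ε < 1) (hδ : 0 < δ) (hδ1 : δ < 1 / 4) (hv : ∑ j, v j ^ 2 = 1)
    (hm : 16 * ε⁻¹ ^ 2 * Real.logb 2 (1 / δ) ≤ Fintype.card β)
    (hva : ∀ j, |v j| ≤ √(ε * Real.log (1 + 4 / ε)) /
          (6 * √(Real.log (1 / δ) * Real.log (Fintype.card β / δ)))) :
    uniformProb {ω : Fin n → β × ZMod 2 |
      ¬ (1 - ε < ∑ i, bucketSums v ω 0 i ^ 2 ∧ ∑ i, bucketSums v ω 0 i ^ 2 < 1 + ε)} ≤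
      4 * δ := by
  classical
  set m : ℝ := (Fintype.card β : ℝ) with hmd
  have hm1 : (1 : ℝ) ≤ m := by rw [hmd]; exact_mod_cast Fintype.card_pos
  set Λ := Real.log (1 + 4 / ε) with hΛd
  set L := Real.log (1 / δ) with hLd
  set H := Real.log (m / δ) with hHd
  have hΛ1 : 1 ≤ Λ := by
    rw [hΛd, Real.le_log_iff_exp_le (by positivity)]
    have h1 : (4 : ℝ) ≤ 4 / ε := by rw [le_div_iff₀ hε]; linarith
    linarith [Real.exp_one_lt_d9]
  have hL : 0 < L := by
    apply Real.log_pos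
    rw [lt_div_iff₀ hδ]; linarith
  have hHL : L ≤ H := by
    apply Real.log_le_log (by positivity)
    gcongr
  have hH : 0 < H := hL.trans_le hHL
  have hm2 : 16 * L ≤ 7 / 10 * (ε ^ 2 * m) := by
    have hl2 : 0 < Real.log 2 := Real.log_pos (by norm_num)
    have hl2' : Real.log 2 ≤ 7 / 10 := by linarith [Real.log_two_lt_d9]
    have h1 : 16 * L ≤ Real.log 2 * (ε ^ 2 * m) := by
      have : 16 * ε⁻¹ ^ 2 * (L / Real.log 2) ≤ m := hm
      have e : 16 * L = (16 * ε⁻¹ ^ 2 * (L / Real.log 2)) * (Real.log 2 * ε ^ 2) := by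
        field_simp
      rw [e]
      calc _ ≤ m * (Real.log 2 * ε ^ 2) := by gcongr
        _ = _ := by ring
    refine h1.trans ?_
    gcongr
  set a := √(ε * Λ) / (6 * √(L * H)) with had
  have ha : 0 < a := by positivity
  have ha2 : a ^ 2 * (36 * (L * H)) = ε * Λ := by
    rw [had, div_pow, mul_pow, Real.sq_sqrt (by positivity), Real.sq_sqrt (by positivity)]
    field_simp
    norm_num
  -- `B` is the largest bound on the bucket sums that `2 K a B ≤ 7 / 10` allows, where `K` bounds
  -- `|θ|` along the whole drift from `± 2 L / ε`. The exponent `Λ / a` for the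
  -- bucket sums makes `cosh Λ - 1` of order `1 / ε`, which `m ≥ 16 L / (ε² log 2)` compensates.
  set B := 7 * ε / (60 * L * a) with hB
  set K := 3 * L / ε with hK
  set q := 5 / 2 * K ^ 2 / m with hq
  have hqL : q ≤ L := by
    rw [hq, hK, div_le_iff₀ (by positivity), div_pow, ← mul_div_assoc, div_le_iff₀ (by positivity)]
    nlinarith
  have hcard : (Fintype.card (Fin n → β × ZMod 2) : ℝ) = (2 * m) ^ n := by
    simp [hmd, mul_comm]
  have hpow : (0 : ℝ) < (2 * m) ^ n := by positivity
  have hbad : uniformProb {ω : Fin n → β × ZMod 2 | ¬ StaysBounded B n v ω 0} ≤ 2 * δ := by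
    have hγ : ∀ x, |x| ≤ a → Real.cosh (Λ / a * x) - 1 ≤ 2 / (ε * a ^ 2) * x ^ 2 := by
      intro x hx
      have h1 : |Λ / a * x| ≤ Λ := by
        rw [abs_mul, abs_of_pos (by positivity)]
        calc Λ / a * |x| ≤ Λ / a * a := by gcongr
          _ = Λ := by field_simp
      refine (cosh_sub_one_le (by linarith) h1).trans ?_
      have h2 : Real.cosh Λ - 1 ≤ 2 / ε := by
        rw [Real.cosh_eq, Real.exp_neg, hΛd, Real.exp_log (by positivity)]
        have h3 : (1 + 4 / ε)⁻¹ ≤ 1 := inv_le_one_of_one_le₀ (by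
          have : 0 < 4 / ε := by positivity
          linarith)
        have h4 : 4 / ε = 2 * (2 / ε) := by ring
        linarith
      calc _ ≤ (Λ / a * x / Λ) ^ 2 * (2 / ε) := by gcongr
        _ = _ := by field_simp
    have h := sum_not_staysBounded_le (β := β) a B (Λ / a) (2 / (ε * a ^ 2)) (by positivity)
      (by positivity) hγ n v 0 hva
    have hexp : -(Λ / a * B) + 2 / (ε * a ^ 2) * (∑ j, v j ^ 2) / m ≤ -H := by
      have e1 : Λ / a * B = 21 / 5 * H := by
        have : Λ / a * B = 7 * (ε * Λ) / (60 * L * a ^ 2) := by rw [hB]; field_simp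
        rw [this, ← ha2]; field_simp; norm_num
      have e2 : 2 / (ε * a ^ 2) * (∑ j, v j ^ 2) / m = 72 * L * H / (ε ^ 2 * m * Λ) := by
        have e3 : a ^ 2 = ε * Λ / (36 * (L * H)) := by rw [← ha2]; field_simp
        rw [hv, e3]; field_simp; norm_num
      have e4 : 72 * L * H / (ε ^ 2 * m * Λ) ≤ 16 / 5 * H := by
        rw [div_le_iff₀ (by positivity)]
        have h5 : 72 * L ≤ 16 / 5 * (ε ^ 2 * m) := by
          have : 0 < ε ^ 2 * m := by positivity
          linarith
        have h6 : 16 / 5 * (ε ^ 2 * m) ≤ 16 / 5 * (ε ^ 2 * m) * Λ :=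
          le_mul_of_one_le_right (by positivity) hΛ1
        nlinarith
      rw [e1, e2]; linarith
    refine (uniformProb_le_sum_div (F := fun ω => if StaysBounded B n v ω 0 then (0 : ℝ) else 1)
      (fun ω => by positivity) (fun ω hω => by
        simp only [Set.mem_ofPred_eq] at hω; simp [hω])).trans ?_
    rw [hcard, div_le_iff₀ hpow]
    refine h.trans ?_
    rw [mul_comm (2 * δ)]
    refine mul_le_mul_of_nonneg_left ?_ hpow.le
    simp only [Pi.zero_apply, mul_zero, Real.cosh_zero, mul_one, Finset.sum_const,
      Finset.card_univ, nsmul_eq_mul]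
    calc _ ≤ Real.exp (-H) * (m * 2) := by gcongr
      _ = 2 * δ := by
        rw [Real.exp_neg, hHd, Real.exp_log (by positivity)]; field_simp
  -- Both tails follow from Markov's inequality, with the exponents `t = ± 2 L / ε`.
  have htail : ∀ t : ℝ, |t| = 2 * L / ε → uniformProb {ω : Fin n → β × ZMod 2 |
      StaysBounded B n v ω 0 ∧ t + 2 * L ≤ t * ∑ i, bucketSums v ω 0 i ^ 2} ≤ δ := by
    intro t ht
    have hKB : 2 * K * a * B ≤ 7 / 10 := by
      rw [hK, hB]; apply le_of_eq; field_simp; norm_num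
    have hLε : L ≤ L / ε := by
      rw [le_div_iff₀ hε]; nlinarith
    have h := sum_exp_sq_norm_le (β := β) a B K q hq hKB n v 0 t hva (by
      rw [ht, hv, hK]
      have : 3 * L / ε = 2 * L / ε + L / ε := by ring
      linarith)
    refine (uniformProb_le_sum_div (F := fun ω => Real.exp (-(t + 2 * L)) *
      if StaysBounded B n v ω 0 then Real.exp (t * ∑ i, bucketSums v ω 0 i ^ 2) else 0)
      (fun ω => by positivity) (fun ω hω => by
        simp only [hω.1, if_true]
        rw [← Real.exp_add]
        exact Real.one_le_exp (by linarith [hω.2]))).trans ?_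
    rw [hcard, div_le_iff₀ hpow, ← Finset.mul_sum]
    calc _ ≤ Real.exp (-(t + 2 * L)) * ((2 * m) ^ n * Real.exp (t + q)) := by
          gcongr
          refine h.trans (le_of_eq ?_)
          simp [hv, ← hmd]
      _ = (2 * m) ^ n * Real.exp (q - 2 * L) := by
          rw [mul_left_comm, ← Real.exp_add]; congr 2; ring
      _ ≤ (2 * m) ^ n * Real.exp (-L) := by gcongr; linarith
      _ = δ * (2 * m) ^ n := by
          rw [Real.exp_neg, hLd, Real.exp_log (by positivity)]; field_simp
  have hpos : 0 < 2 * L / ε := by positivity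
  have h1 := htail (2 * L / ε) (abs_of_pos hpos)
  have h2 := htail (-(2 * L / ε)) (by rw [abs_neg, abs_of_pos hpos])
  have hsub : {ω : Fin n → β × ZMod 2 |
      ¬ (1 - ε < ∑ i, bucketSums v ω 0 i ^ 2 ∧ ∑ i, bucketSums v ω 0 i ^ 2 < 1 + ε)} ⊆
      {ω | ¬ StaysBounded B n v ω 0} ∪
      ({ω | StaysBounded B n v ω 0 ∧
        2 * L / ε + 2 * L ≤ 2 * L / ε * ∑ i, bucketSums v ω 0 i ^ 2} ∪
      {ω | StaysBounded B n v ω 0 ∧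
        -(2 * L / ε) + 2 * L ≤ -(2 * L / ε) * ∑ i, bucketSums v ω 0 i ^ 2}) := by
    intro ω hω
    by_cases hs : StaysBounded B n v ω 0
    · right
      have e : 2 * L = 2 * L / ε * ε := by field_simp
      rcases not_and_or.1 hω with h3 | h3
      · right
        refine ⟨hs, ?_⟩
        push Not at h3
        calc -(2 * L / ε) + 2 * L = -(2 * L / ε * (1 - ε)) := by linear_combination e
          _ ≤ -(2 * L / ε * ∑ i, bucketSums v ω 0 i ^ 2) := by gcongr
          _ = _ := by ring
      · left
        refine ⟨hs, ?_⟩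
        push Not at h3
        calc 2 * L / ε + 2 * L = 2 * L / ε * (1 + ε) := by linear_combination e
          _ ≤ _ := by gcongr
    · left; exact hs
  have h3 := uniformProb_mono hsub
  have h4 := uniformProb_union_le {ω : Fin n → β × ZMod 2 | ¬ StaysBounded B n v ω 0}
      ({ω | StaysBounded B n v ω 0 ∧
        2 * L / ε + 2 * L ≤ 2 * L / ε * ∑ i, bucketSums v ω 0 i ^ 2} ∪
      {ω | StaysBounded B n v ω 0 ∧
        -(2 * L / ε) + 2 * L ≤ -(2 * L / ε) * ∑ i, bucketSums v ω 0 i ^ 2})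
  have h5 := uniformProb_union_le {ω : Fin n → β × ZMod 2 | StaysBounded B n v ω 0 ∧
        2 * L / ε + 2 * L ≤ 2 * L / ε * ∑ i, bucketSums v ω 0 i ^ 2}
      {ω | StaysBounded B n v ω 0 ∧
        -(2 * L / ε) + 2 * L ≤ -(2 * L / ε) * ∑ i, bucketSums v ω 0 i ^ 2}
  linarith

lemma uniformProb_featureHashing_le [Nonempty β] {κ : Type} [Fintype κ] (v : κ → ℝ) (ε δ : ℝ)
    (hε : 0 < ε) (hε1 : ε < 1) (hδ : 0 < δ) (hδ1 : δ < 1 / 4) (hv : ∑ j, v j ^ 2 = 1)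
    (hm : 16 * ε⁻¹ ^ 2 * Real.logb 2 (1 / δ) ≤ Fintype.card β)
    (hva : ∀ j, |v j| ≤ √(ε * Real.log (1 + 4 / ε)) /
          (6 * √(Real.log (1 / δ) * Real.log (Fintype.card β / δ)))) :
    uniformProb {ω : κ → β × ZMod 2 |
      ¬ (1 - ε < ∑ i, bucketSums v ω 0 i ^ 2 ∧ ∑ i, bucketSums v ω 0 i ^ 2 < 1 + ε)} ≤
      4 * δ := by
  classical
  let e := Fintype.equivFin κ
  have h := uniformProb_fin_featureHashing_le (β := β) (fun j => v (e.symm j)) ε δ hε hε1 hδ hδ1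
    (by rw [← hv]; exact e.symm.sum_comp fun j => v j ^ 2) hm (fun j => hva _)
  rw [← uniformProb_preimage_equiv (Equiv.arrowCongr e (Equiv.refl (β × ZMod 2)))] at h
  convert h using 3
  ext ω
  have : ∀ i, bucketSums v ω 0 i = bucketSums (fun j => v (e.symm j))
      ((Equiv.arrowCongr e (Equiv.refl (β × ZMod 2))) ω) 0 i := by
    intro i
    simp only [bucketSums, Equiv.arrowCongr_apply, Equiv.coe_refl, Function.comp, id]
    congr 1
    exact (e.symm.sum_comp fun j => if (ω j).1 = i then signVal (ω j).2 * v j else 0).symm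
  simp only [Set.mem_ofPred_eq, Set.mem_preimage, this]

end RandomFeatureHashingTail

/-! ### Linear independence and uniform hash values -/

section LinearIndependence

/-- The exclusive or of the entries of the table `τ` at the positions in the support of `u`. -/
def tableSum {P : Type} [Fintype P] {r : ℕ} (u : P → ZMod 2) (τ : P → Bits r) : Bits r :=
  ∑ p, u p • τ p

lemma tableSum_add {P : Type} [Fintype P] {r : ℕ} (u : P → ZMod 2) (τ τ' : P → Bits r) :
    tableSum u (τ + τ') = tableSum u τ + tableSum u τ' := by
  simp [tableSum, Finset.sum_add_distrib]

lemma tableSum_surjective {P κ : Type} [Fintype P] [Fintype κ] {r : ℕ} {u : κ → P → ZMod 2}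
    (hu : LinearIndependent (ZMod 2) u) :
    Function.Surjective fun (τ : P → Bits r) k => tableSum (u k) τ := by
  classical
  let M : Matrix κ P (ZMod 2) := u
  have hrank : M.rank = Fintype.card κ := LinearIndependent.rank_matrix hu
  have hsurj : Function.Surjective M.mulVecLin := by
    rw [← LinearMap.range_eq_top]
    apply Submodule.eq_top_of_finrank_eq
    rw [Module.finrank_fintype_fun_eq_card, ← hrank]
    rfl
  intro y
  choose x hx using fun t : Fin r => hsurj fun k => y k t
  refine ⟨fun p t => x t p, ?_⟩
  funext k t
  have := congrFun (hx t) k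
  simp only [Matrix.mulVecLin_apply, Matrix.mulVec, dotProduct] at this
  rw [← this]
  simp [tableSum, M]

lemma uniformProb_tableSum_eq_zero {P κ : Type} [Fintype P] [Fintype κ] {r : ℕ}
    {u : κ → P → ZMod 2} (hu : LinearIndependent (ZMod 2) u) :
    uniformProb {τ : P → Bits r | ∀ k, tableSum (u k) τ = 0} =
      ((2 : ℝ) ^ r)⁻¹ ^ Fintype.card κ := by
  classical
  have h := uniformProb_preimage_of_surjective
    (fun (τ : P → Bits r) (k : κ) => tableSum (u k) τ)
    (fun x y => by funext k; simp [tableSum_add]) (tableSum_surjective hu) {0}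
  have e : ((fun (τ : P → Bits r) (k : κ) => tableSum (u k) τ) ⁻¹' {0}) =
      {τ : P → Bits r | ∀ k, tableSum (u k) τ = 0} := by
    ext τ; simp [funext_iff]
  rw [← e, h]
  simp [uniformProb, Nat.card_eq_fintype_card]

/-- A family of vectors is linearly independent if each of them has a nonzero coordinate at which
all earlier vectors vanish. -/
lemma linearIndependent_of_triangular {P : Type} : ∀ {k : ℕ} (u : Fin k → P → ZMod 2),
    (∀ i, ∃ p, u i p ≠ 0 ∧ ∀ j < i, u j p = 0) → LinearIndependent (ZMod 2) u := by
  intro k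
  induction k with
  | zero => intro u _; exact linearIndependent_empty_type
  | succ k ih =>
    intro u h
    rw [linearIndependent_finSucc']
    refine ⟨ih _ fun i => ?_, fun hspan => ?_⟩
    · obtain ⟨p, hp, hj⟩ := h i.castSucc
      exact ⟨p, hp, fun j hji => hj _ (by simpa using hji)⟩
    · obtain ⟨p, hp, hj⟩ := h (Fin.last k)
      refine hp ?_
      have hle : Submodule.span (ZMod 2) (Set.range fun i : Fin k => u i.castSucc) ≤
          LinearMap.ker (LinearMap.proj (R := ZMod 2) (φ := fun _ : P => ZMod 2) p) := by
        rw [Submodule.span_le]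
        rintro _ ⟨i, rfl⟩
        simpa using hj _ (Fin.castSucc_lt_last i)
      simpa using hle hspan

end LinearIndependence

/-! ### Counting quadruples of keys -/

section Quadruples

variable {A : Type} [Fintype A]

/-- Tensorization of an `ℓ²` bound: if at every coordinate the admissible tuples of characters
have norm at most `C` as a multilinear form on `ℓ²`, then the tuples of keys that are admissible at
all `c` coordinates have norm at most `C ^ c`. -/
lemma sum_prod_le_of_coordinatewise {κ : Type} [Fintype κ] [DecidableEq κ] {C : ℝ} (hC : 0 ≤ C) :
    ∀ (c : ℕ) (R : Fin c → Set (κ → A)),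
      (∀ p, ∀ φ : κ → A → ℝ, (∀ k a, 0 ≤ φ k a) →
        ∑ α : κ → A, (open Classical in if α ∈ R p then ∏ k, φ k (α k) else 0) ≤
          C * ∏ k, √(∑ a, φ k a ^ 2)) →
      ∀ f : κ → (Fin c → A) → ℝ, (∀ k x, 0 ≤ f k x) →
        ∑ x : κ → Fin c → A, (open Classical in
          if ∀ p, (fun k => x k p) ∈ R p then ∏ k, f k (x k) else 0) ≤
          C ^ c * ∏ k, √(∑ y, f k y ^ 2) := by
  classical
  intro c
  induction c with
  | zero =>
    intro R _ f hf
    simp only [IsEmpty.forall_iff, if_true, pow_zero, one_mul]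
    rw [Fintype.sum_unique]
    refine le_of_eq (Finset.prod_congr rfl fun k _ => ?_)
    rw [Fintype.sum_unique, Real.sqrt_sq (hf _ _)]
    rfl
  | succ c ih =>
    intro R hR f hf
    let e : (κ → A) × (κ → Fin c → A) ≃ (κ → Fin (c + 1) → A) :=
      (Equiv.arrowProdEquivProdArrow κ (fun _ => A) (fun _ => Fin c → A)).symm.trans
        (Equiv.arrowCongr (Equiv.refl κ) (Fin.consEquiv fun _ => A))
    have he : ∀ α x k, e (α, x) k = Fin.cons (α k) (x k) := fun _ _ _ => rfl
    rw [← e.sum_comp, Fintype.sum_prod_type]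
    have step : ∀ α : κ → A, ∑ x : κ → Fin c → A,
        (if ∀ p, (fun k => e (α, x) k p) ∈ R p then ∏ k, f k (e (α, x) k) else 0) ≤
        if α ∈ R 0 then C ^ c * ∏ k, √(∑ y : Fin c → A, f k (Fin.cons (α k) y) ^ 2) else 0 := by
      intro α
      by_cases hα : α ∈ R 0
      · rw [if_pos hα]
        have := ih (fun p => R p.succ) (fun p => hR p.succ) (fun k y => f k (Fin.cons (α k) y))
          (fun k y => hf _ _)
        simpa [he, Fin.forall_fin_succ, hα] using this
      · rw [if_neg hα]
        refine le_of_eq (Finset.sum_eq_zero fun x _ => if_neg fun h => hα ?_)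
        simpa [he] using h 0
    refine (Finset.sum_le_sum fun α _ => step α).trans ?_
    have h1 := hR 0 (fun k a => √(∑ y : Fin c → A, f k (Fin.cons a y) ^ 2))
      (fun _ _ => Real.sqrt_nonneg _)
    have h2 : ∀ k, ∑ y : Fin (c + 1) → A, f k y ^ 2 =
        ∑ a, √(∑ y : Fin c → A, f k (Fin.cons a y) ^ 2) ^ 2 := by
      intro k
      rw [sum_fin_succ_fun]
      refine Finset.sum_congr rfl fun a _ => ?_
      rw [Real.sq_sqrt (Finset.sum_nonneg fun _ _ => sq_nonneg _)]
    simp only [h2]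
    calc _ = C ^ c * ∑ α : κ → A, (if α ∈ R 0 then
            ∏ k, √(∑ y : Fin c → A, f k (Fin.cons (α k) y) ^ 2) else 0) := by
          rw [Finset.mul_sum]
          exact Finset.sum_congr rfl fun α _ => by split_ifs <;> simp
      _ ≤ _ := by
          rw [pow_succ, mul_assoc]
          gcongr

/-- Two characters are equal or both belong to `Q`. -/
def EqOrMem (Q : Finset A) (a b : A) : Prop := a = b ∨ (a ∈ Q ∧ b ∈ Q)

lemma sum_eqOrMem_le (Q : Finset A) (φ ψ : A → ℝ) (hφ : ∀ a, 0 ≤ φ a) (hψ : ∀ a, 0 ≤ ψ a) :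
    ∑ a, ∑ b, (open Classical in if EqOrMem Q a b then φ a * ψ b else 0) ≤
      (1 + Q.card) * (√(∑ a, φ a ^ 2) * √(∑ a, ψ a ^ 2)) := by
  classical
  have hle : ∀ a b, (if EqOrMem Q a b then φ a * ψ b else 0) ≤
      (if a = b then φ a * ψ b else 0) + if a ∈ Q ∧ b ∈ Q then φ a * ψ b else 0 := by
    intro a b
    have := mul_nonneg (hφ a) (hψ b)
    unfold EqOrMem
    split_ifs <;> first | linarith | tauto
  have h1 : ∑ a, φ a * ψ a ≤ √(∑ a, φ a ^ 2) * √(∑ a, ψ a ^ 2) :=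
    Real.sum_mul_le_sqrt_mul_sqrt _ _ _
  have hQ : ∀ χ : A → ℝ, (∀ a, 0 ≤ χ a) → ∑ a ∈ Q, χ a ≤ √Q.card * √(∑ a, χ a ^ 2) := by
    intro χ _
    have := Real.sum_mul_le_sqrt_mul_sqrt Q (fun _ => (1 : ℝ)) χ
    simp only [one_mul, one_pow, Finset.sum_const, nsmul_eq_mul, mul_one] at this
    refine this.trans ?_
    gcongr
    exact Finset.subset_univ Q
  have h2 : (∑ a ∈ Q, φ a) * (∑ b ∈ Q, ψ b) ≤
      Q.card * (√(∑ a, φ a ^ 2) * √(∑ a, ψ a ^ 2)) := by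
    calc _ ≤ (√Q.card * √(∑ a, φ a ^ 2)) * (√Q.card * √(∑ a, ψ a ^ 2)) := by
          gcongr
          · exact Finset.sum_nonneg fun a _ => hψ a
          · exact hQ φ hφ
          · exact hQ ψ hψ
      _ = (√Q.card * √Q.card) * (√(∑ a, φ a ^ 2) * √(∑ a, ψ a ^ 2)) := by ring
      _ = _ := by rw [Real.mul_self_sqrt (by positivity)]
  have h3 : ∑ a, ∑ b, (if a ∈ Q ∧ b ∈ Q then φ a * ψ b else 0) =
      (∑ a ∈ Q, φ a) * (∑ b ∈ Q, ψ b) := by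
    simp [Finset.sum_mul_sum, ite_and, Finset.sum_ite_mem]
  calc _ ≤ ∑ a, ∑ b, ((if a = b then φ a * ψ b else 0) +
          if a ∈ Q ∧ b ∈ Q then φ a * ψ b else 0) :=
        Finset.sum_le_sum fun a _ => Finset.sum_le_sum fun b _ => hle a b
    _ = ∑ a, φ a * ψ a + (∑ a ∈ Q, φ a) * (∑ b ∈ Q, ψ b) := by
        simp only [Finset.sum_add_distrib, Finset.sum_ite_eq, Finset.mem_univ, if_true, h3]
    _ ≤ _ := by linarith

/-- Permutations of four indices that list the two edges of each of the three perfect matchings. -/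
def matchingPerm : Fin 3 → Equiv.Perm (Fin 4) :=
  ![1, Equiv.swap 1 2, Equiv.swap 1 3]

lemma sum_matching_le (Q : Finset A) (σ : Equiv.Perm (Fin 4)) (φ : Fin 4 → A → ℝ)
    (hφ : ∀ k a, 0 ≤ φ k a) :
    ∑ α : Fin 4 → A, (open Classical in
      if EqOrMem Q (α (σ 0)) (α (σ 1)) ∧ EqOrMem Q (α (σ 2)) (α (σ 3)) then
        ∏ k, φ k (α k) else 0) ≤ (1 + Q.card : ℝ) ^ 2 * ∏ k, √(∑ a, φ k a ^ 2) := by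
  classical
  have h1 : ∑ α : Fin 4 → A,
      (if EqOrMem Q (α (σ 0)) (α (σ 1)) ∧ EqOrMem Q (α (σ 2)) (α (σ 3)) then
        ∏ k, φ k (α k) else 0) =
      ∑ α : Fin 4 → A, (if EqOrMem Q (α 0) (α 1) ∧ EqOrMem Q (α 2) (α 3) then
        ∏ k, φ (σ k) (α k) else 0) := by
    rw [← (Equiv.arrowCongr σ (Equiv.refl A)).sum_comp]
    refine Finset.sum_congr rfl fun α _ => ?_
    simp only [Equiv.arrowCongr_apply, Equiv.coe_refl, Function.comp, id, Equiv.symm_apply_apply]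
    rw [← Equiv.prod_comp σ]
    simp
  rw [h1]
  have h2 : ∑ α : Fin 4 → A, (if EqOrMem Q (α 0) (α 1) ∧ EqOrMem Q (α 2) (α 3) then
        ∏ k, φ (σ k) (α k) else 0) =
      (∑ a, ∑ b, if EqOrMem Q a b then φ (σ 0) a * φ (σ 1) b else 0) *
      ∑ a, ∑ b, if EqOrMem Q a b then φ (σ 2) a * φ (σ 3) b else 0 := by
    rw [sum_fin_succ_fun]
    simp only [sum_fin_succ_fun (n := 2), sum_fin_succ_fun (n := 1), sum_fin_succ_fun (n := 0),
      Fintype.sum_unique]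
    rw [Finset.sum_mul]
    refine Finset.sum_congr rfl fun a _ => ?_
    rw [Finset.sum_mul]
    refine Finset.sum_congr rfl fun b _ => ?_
    rw [Finset.mul_sum]
    refine Finset.sum_congr rfl fun a' _ => ?_
    rw [Finset.mul_sum]
    refine Finset.sum_congr rfl fun b' _ => ?_
    have e0 : (Fin.cons a (Fin.cons b (Fin.cons a' (Fin.cons b' default))) : Fin 4 → A) =
        ![a, b, a', b'] := by
      funext i; fin_cases i <;> rfl
    rw [e0]
    simp only [Fin.prod_univ_four, Matrix.cons_val]
    by_cases h : EqOrMem Q a b <;> by_cases h' : EqOrMem Q a' b' <;> simp [h, h', mul_assoc]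
  rw [h2, ← Equiv.prod_comp σ, Fin.prod_univ_four]
  have ha := sum_eqOrMem_le Q (φ (σ 0)) (φ (σ 1)) (hφ _) (hφ _)
  have hb := sum_eqOrMem_le Q (φ (σ 2)) (φ (σ 3)) (hφ _) (hφ _)
  refine (mul_le_mul ha hb ?_ (by positivity)).trans (le_of_eq (by ring))
  refine Finset.sum_nonneg fun a _ => Finset.sum_nonneg fun b _ => ?_
  split_ifs
  · exact mul_nonneg (hφ _ _) (hφ _ _)
  · exact le_rfl

omit [Fintype A] in
/-- If four characters cancel outside of `Q`, then along one of the three perfect matchings the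
matched characters are equal or both in `Q`. -/
lemma exists_matchingPerm [DecidableEq A] (Q : Finset A) (α : Fin 4 → A)
    (h : ∀ a ∉ Q, ∑ k, (if α k = a then (1 : ZMod 2) else 0) = 0) :
    ∃ s, EqOrMem Q (α (matchingPerm s 0)) (α (matchingPerm s 1)) ∧
      EqOrMem Q (α (matchingPerm s 2)) (α (matchingPerm s 3)) := by
  have hs : ∀ P : Fin 3 → Prop, (∃ s, P s) ↔ P 0 ∨ P 1 ∨ P 2 := by
    intro P; simp [Fin.exists_fin_succ]
  have h2 : (1 : ZMod 2) + 1 = 0 := rfl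
  have h1 : (1 : ZMod 2) ≠ 0 := one_ne_zero
  rw [hs]
  have p0 : ∀ k, matchingPerm 0 k = k := fun k => rfl
  have p1 : matchingPerm 1 0 = 0 ∧ matchingPerm 1 1 = 2 ∧ matchingPerm 1 2 = 1 ∧
    matchingPerm 1 3 = 3 := by decide
  have p2 : matchingPerm 2 0 = 0 ∧ matchingPerm 2 1 = 3 ∧ matchingPerm 2 2 = 2 ∧
    matchingPerm 2 3 = 1 := by decide
  simp only [p0, p1, p2, EqOrMem]
  simp only [Fin.sum_univ_four] at h
  have q0 := h (α 0)
  have q1 := h (α 1)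
  have q2 := h (α 2)
  have q3 := h (α 3)
  clear h
  generalize α 0 = a, α 1 = b, α 2 = c, α 3 = d at *
  by_cases ab : a = b <;> by_cases ac : a = c <;> by_cases ad : a = d <;>
    by_cases bc : b = c <;> by_cases bd : b = d <;> by_cases cd : c = d <;>
    simp_all <;> grind

/-- The number of quadruples of keys from a set of `n` keys whose characters cancel outside of a
set of at most `q` characters at every coordinate is `O(n ^ 2)`. -/
lemma card_quadruples_le [DecidableEq A] {c : ℕ} (X : Finset (Fin c → A)) (Q : Fin c → Finset A)
    (q : ℕ) (hQ : ∀ p, (Q p).card ≤ q) :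
    ((Fintype.piFinset fun _ : Fin 4 => X).filter fun x =>
      ∀ p, ∀ a ∉ Q p, ∑ k, (if x k p = a then (1 : ZMod 2) else 0) = 0).card ≤
      (3 * (1 + q) ^ 2) ^ c * X.card ^ 2 := by
  classical
  obtain ⟨R, hR⟩ : ∃ R : Fin c → Set (Fin 4 → A), ∀ p α, α ∈ R p ↔
      ∀ a ∉ Q p, ∑ k, (if α k = a then (1 : ZMod 2) else 0) = 0 :=
    ⟨fun p => {α | ∀ a ∉ Q p, ∑ k, (if α k = a then (1 : ZMod 2) else 0) = 0},
      fun _ _ => Iff.rfl⟩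
  have h := sum_prod_le_of_coordinatewise (A := A) (κ := Fin 4) (C := 3 * (1 + q : ℝ) ^ 2)
    (by positivity) c R (by
      intro p φ hφ
      have hle : ∀ α : Fin 4 → A,
          (if α ∈ R p then
            ∏ k, φ k (α k) else 0) ≤
          ∑ s, if EqOrMem (Q p) (α (matchingPerm s 0)) (α (matchingPerm s 1)) ∧
            EqOrMem (Q p) (α (matchingPerm s 2)) (α (matchingPerm s 3)) then
            ∏ k, φ k (α k) else 0 := by
        intro α
        have h0 : 0 ≤ ∏ k, φ k (α k) := Finset.prod_nonneg fun k _ => hφ _ _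
        have hnn : ∀ s, 0 ≤ (if EqOrMem (Q p) (α (matchingPerm s 0)) (α (matchingPerm s 1)) ∧
            EqOrMem (Q p) (α (matchingPerm s 2)) (α (matchingPerm s 3)) then
            ∏ k, φ k (α k) else 0) := fun s => by split_ifs <;> simp [h0]
        by_cases hα : α ∈ R p
        · rw [if_pos hα]
          obtain ⟨s, hs⟩ := exists_matchingPerm (Q p) α ((hR p α).1 hα)
          refine le_trans ?_ (Finset.single_le_sum (fun s _ => hnn s) (Finset.mem_univ s))
          rw [if_pos hs]
        · rw [if_neg hα]
          exact Finset.sum_nonneg fun s _ => hnn s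
      refine (Finset.sum_le_sum fun α _ => hle α).trans ?_
      rw [Finset.sum_comm]
      refine (Finset.sum_le_sum fun s _ => sum_matching_le (Q p) (matchingPerm s) φ hφ).trans ?_
      rw [Finset.sum_const, Finset.card_univ, Fintype.card_fin, nsmul_eq_mul, ← mul_assoc]
      have : ((Q p).card : ℝ) ≤ q := by exact_mod_cast hQ p
      push_cast
      gcongr)
    (fun _ x => if x ∈ X then 1 else 0) (fun _ _ => by positivity)
  have e1 : (∏ _k : Fin 4, √(∑ y : Fin c → A, (if y ∈ X then (1 : ℝ) else 0) ^ 2)) =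
      (X.card : ℝ) ^ 2 := by
    have : ∑ y : Fin c → A, (if y ∈ X then (1 : ℝ) else 0) ^ 2 = X.card := by
      simp
    rw [this, Finset.prod_const, Finset.card_univ, Fintype.card_fin,
      show (4 : ℕ) = 2 * 2 from rfl, pow_mul, Real.sq_sqrt (by positivity)]
  rw [e1] at h
  rw [← Nat.cast_le (α := ℝ)]
  push_cast
  refine le_trans (le_of_eq ?_) h
  rw [Finset.card_filter, Nat.cast_sum, ← Finset.sum_subset (Finset.subset_univ
    (Fintype.piFinset fun _ : Fin 4 => X))]
  · refine Finset.sum_congr rfl fun x hx => ?_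
    have hx' : ∀ k, x k ∈ X := by simpa using hx
    simp [hx', hR]
  · intro x _ hx
    have : ∃ k, x k ∉ X := by simpa using hx
    obtain ⟨k, hk⟩ := this
    rw [Finset.prod_eq_zero (Finset.mem_univ k) (by simp [hk])]
    simp

end Quadruples

/-! ### Walks in the core of a pair of simple tabulation functions -/

section Walks

variable {A : Type} [Fintype A] [DecidableEq A]

/-- The indicator vector of the positions `(i, x i)`, i.e. of the table entries that a simple
tabulation function looks up for the key `x`. -/
def charVec {ι : Type} (x : ι → A) : ι × A → ZMod 2 := fun p => if x p.1 = p.2 then 1 else 0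

/-- The positions of two simple tabulation functions, with indices `0` and `1`. -/
abbrev PairPos (c : ℕ) (A : Type) : Type := (Fin 2 × Fin c) × A

/-- The value of the `t`-th of two simple tabulation functions at the key `x`. -/
def simpleTab {c r : ℕ} (τ : PairPos c A → Bits r) (t : Fin 2) (x : Fin c → A) : Bits r :=
  ∑ i, τ ((t, i), x i)

/-- The vector expressing that the `t`-th function takes the same value at `x` and at `y`. -/
def linkVec {c : ℕ} (t : Fin 2) (x y : Fin c → A) : PairPos c A → ZMod 2 :=
  fun p => if p.1.1 = t then charVec x (p.1.2, p.2) + charVec y (p.1.2, p.2) else 0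

lemma tableSum_charVec {ι : Type} [Fintype ι] {r : ℕ} (x : ι → A) (τ : ι × A → Bits r) :
    tableSum (charVec x) τ = ∑ i, τ (i, x i) := by
  simp [tableSum, charVec, Fintype.sum_prod_type]

lemma tableSum_linkVec {c r : ℕ} (t : Fin 2) (x y : Fin c → A) (τ : PairPos c A → Bits r) :
    tableSum (linkVec t x y) τ = simpleTab τ t x + simpleTab τ t y := by
  simp only [tableSum, linkVec, charVec, simpleTab, Fintype.sum_prod_type, ite_smul, add_smul,
    one_smul, zero_smul]
  rw [Finset.sum_eq_single t]
  · simp [Finset.sum_add_distrib]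
  · intro t' _ ht'
    simp [ht']
  · simp

lemma bits_add_self {r : ℕ} (x : Bits r) : x + x = 0 := by
  funext i
  exact CharTwo.add_self_eq_zero _

lemma tableSum_linkVec_eq_zero {c r : ℕ} {t : Fin 2} {x y : Fin c → A} {τ : PairPos c A → Bits r}
    (h : simpleTab τ t y = simpleTab τ t x) : tableSum (linkVec t x y) τ = 0 := by
  rw [tableSum_linkVec, h, bits_add_self]

/-- The key `x` belongs to the core of `X`: to a subset of `X` in which every key shares each of
its two values with another key. -/
def InCore {c r : ℕ} (X : Finset (Fin c → A)) (τ : PairPos c A → Bits r) (x : Fin c → A) : Prop :=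
  ∃ Y ⊆ X, x ∈ Y ∧ ∀ y ∈ Y, ∀ t, ∃ y' ∈ Y, y' ≠ y ∧ simpleTab τ t y' = simpleTab τ t y

/-- The function whose values the `i`-th step of a walk preserves: the two functions alternate. -/
def stepType (i : ℕ) : Fin 2 := Fin.ofNat 2 i

lemma stepType_eq_iff {i j : ℕ} : stepType i = stepType j ↔ i % 2 = j % 2 := by
  simp [stepType, Fin.ext_iff]

/-- The vector of the `i`-th step of the walk `z`. -/
def stepVec {c w : ℕ} (z : Fin (w + 2) → Fin c → A) (i : Fin (w + 1)) : PairPos c A → ZMod 2 :=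
  linkVec (stepType i) (z i.castSucc) (z i.succ)

/-- A walk with `w + 1` steps, whose last step is not constant, is closing if each of its keys but
the last has a character that no earlier key has, and the last one has no such character. -/
structure IsClosing {c w : ℕ} (z : Fin (w + 2) → Fin c → A) : Prop where
  fresh : ∀ j : Fin (w + 1), ∃ p, ∀ i < j, z i.castSucc p ≠ z j.castSucc p
  covered : ∀ p, ∃ j : Fin (w + 1), z j.castSucc p = z (Fin.last _) p
  ne : z (Fin.last w).castSucc ≠ z (Fin.last _)

omit [Fintype A] [DecidableEq A] in
lemma IsClosing.lt_card {c w : ℕ} {z : Fin (w + 2) → Fin c → A} (hz : IsClosing z)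
    {X : Finset (Fin c → A)} (hX : ∀ j, z j ∈ X) : w < X.card := by
  have hinj : Function.Injective fun j : Fin (w + 1) => z j.castSucc := by
    have hlt : ∀ i j : Fin (w + 1), i < j → z i.castSucc ≠ z j.castSucc := by
      intro i j hij h
      obtain ⟨p, hp⟩ := hz.fresh j
      exact hp i hij (congrFun h p)
    intro i j hij
    by_contra hne
    rcases lt_or_gt_of_ne hne with h | h
    · exact hlt i j h hij
    · exact hlt j i h hij.symm
  have := Finset.card_le_card_of_injOn (s := (Finset.univ : Finset (Fin (w + 1)))) (t := X)
    (fun j => z j.castSucc) (fun j _ => hX _) hinj.injOn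
  simpa using this

/-- From every key of the core starts a closing walk. -/
lemma InCore.exists_closing {c r : ℕ} (hc : 0 < c) {X : Finset (Fin c → A)}
    {τ : PairPos c A → Bits r} {x : Fin c → A} (hx : InCore X τ x) :
    ∃ w, ∃ z : Fin (w + 2) → Fin c → A, (∀ j, z j ∈ X) ∧ IsClosing z ∧ z 0 = x ∧
      ∀ i, tableSum (stepVec z i) τ = 0 := by
  classical
  obtain ⟨Y, hYX, hxY, hY⟩ := hx
  choose! f hfY hfne hf using hY
  let y : ℕ → Fin c → A := fun n => Nat.rec x (fun n y => f y (stepType n)) n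
  have hy0 : y 0 = x := rfl
  have hys : ∀ n, y (n + 1) = f (y n) (stepType n) := fun _ => rfl
  have hyY : ∀ n, y n ∈ Y := by
    intro n
    induction n with
    | zero => exact hxY
    | succ n ih => exact hfY _ ih _
  have hrep : ∃ n, ∀ p, ∃ j < n, y j p = y n p := by
    obtain ⟨i, j, hij, h⟩ := Finite.exists_ne_map_eq_of_infinite y
    rcases lt_or_gt_of_ne hij with hlt | hlt
    · exact ⟨j, fun p => ⟨i, hlt, congrFun h p⟩⟩
    · exact ⟨i, fun p => ⟨j, hlt, congrFun h.symm p⟩⟩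
  obtain ⟨n, hn, hmin⟩ : ∃ n, (∀ p, ∃ j < n, y j p = y n p) ∧
      ∀ m < n, ¬ ∀ p, ∃ j < m, y j p = y m p :=
    by exact ⟨Nat.find hrep, Nat.find_spec hrep, fun m hm => Nat.find_min hrep hm⟩
  obtain ⟨w, rfl⟩ : ∃ w, n = w + 1 := by
    refine Nat.exists_eq_succ_of_ne_zero ?_
    rintro rfl
    obtain ⟨j, hj, -⟩ := hn ⟨0, hc⟩
    omega
  refine ⟨w, fun j => y j, fun j => hYX (hyY _), ⟨fun j => ?_, fun p => ?_, ?_⟩, hy0,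
    fun i => ?_⟩
  · have := hmin j j.2
    push Not at this
    obtain ⟨p, hp⟩ := this
    exact ⟨p, fun i hi => hp i (by simpa using hi)⟩
  · obtain ⟨j, hj, h⟩ := hn p
    exact ⟨⟨j, hj⟩, by simpa using h⟩
  · simpa [hys] using (hfne _ (hyY w) (stepType w)).symm
  · apply tableSum_linkVec_eq_zero
    simpa [hys] using hf _ (hyY i) (stepType i)

omit [Fintype A] in
lemma IsClosing.linearIndependent {c w : ℕ} {z : Fin (w + 2) → Fin c → A} (hz : IsClosing z) :
    LinearIndependent (ZMod 2) fun i : Fin w => stepVec z i.castSucc := by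
  apply linearIndependent_of_triangular
  intro i
  obtain ⟨p, hp⟩ := hz.fresh i.succ
  have h0 : ∀ j : Fin (w + 1), j < i.succ → charVec (z j.castSucc) (p, z i.succ.castSucc p) = 0 :=
    fun j hj => if_neg (hp j hj)
  refine ⟨((stepType (i.castSucc : ℕ), p), z i.succ.castSucc p), ?_, fun j hj => ?_⟩
  · have h1 := h0 i.castSucc Fin.castSucc_lt_succ
    simp only [stepVec, linkVec, if_true, h1, Fin.succ_castSucc]
    simp [charVec]
  · have h1 := h0 j.castSucc (by
      rw [Fin.lt_def] at hj ⊢; simp; omega)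
    have h2 := h0 j.succ (by
      rw [Fin.lt_def] at hj ⊢; simp; omega)
    simp only [stepVec, linkVec, h1, Fin.succ_castSucc, h2]
    simp

lemma uniformProb_steps_le {c r w : ℕ} {z : Fin (w + 2) → Fin c → A} (hz : IsClosing z) :
    uniformProb {τ : PairPos c A → Bits r | ∀ i, tableSum (stepVec z i) τ = 0} ≤
      ((2 : ℝ) ^ r)⁻¹ ^ w := by
  have h := uniformProb_tableSum_eq_zero (r := r) hz.linearIndependent
  rw [Fintype.card_fin] at h
  rw [← h]
  exact uniformProb_mono fun τ hτ i => hτ _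

lemma uniformProb_steps_eq {c r w : ℕ} {z : Fin (w + 2) → Fin c → A} (hz : IsClosing z)
    (hspan : stepVec z (Fin.last w) ∉
      Submodule.span (ZMod 2) (Set.range fun i : Fin w => stepVec z i.castSucc)) :
    uniformProb {τ : PairPos c A → Bits r | ∀ i, tableSum (stepVec z i) τ = 0} =
      ((2 : ℝ) ^ r)⁻¹ ^ (w + 1) := by
  have hli : LinearIndependent (ZMod 2) (stepVec z) := by
    rw [linearIndependent_finSucc']
    exact ⟨hz.linearIndependent, hspan⟩
  have h := uniformProb_tableSum_eq_zero (r := r) hli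
  rwa [Fintype.card_fin] at h

/-- The characters of the keys `z j` with `j` outside of the range of `J` at the coordinate `p`. -/
def otherChars {c N : ℕ} (J : Fin 4 → Fin N) (z : Fin N → Fin c → A) (p : Fin c) : Finset A :=
  (Finset.univ.filter fun j => ∀ k, J k ≠ j).image fun j => z j p

/-- The four keys `z (J k)` cancel outside of the characters of the other keys. -/
def Cancels {c N : ℕ} (J : Fin 4 → Fin N) (z : Fin N → Fin c → A) : Prop :=
  ∀ p, ∀ a ∉ otherChars J z p, ∑ k, (if z (J k) p = a then (1 : ZMod 2) else 0) = 0

open Classical in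
/-- There are `O(n ^ (N - 2))` tuples of `N` keys with four given keys that cancel outside of the
characters of the others. -/
lemma card_cancels_le {c M : ℕ} (X : Finset (Fin c → A)) (J : Fin 4 → Fin (M + 4))
    (hJ : Function.Injective J) :
    ((Fintype.piFinset fun _ : Fin (M + 4) => X).filter (Cancels J)).card ≤
      (3 * (1 + M) ^ 2) ^ c * X.card ^ 2 * X.card ^ M := by
  let O := {j : Fin (M + 4) // ∀ k, J k ≠ j}
  have hO : Fintype.card O = M := by
    have h1 : Fintype.card O = (Finset.univ \ Finset.univ.image J).card := by
      rw [Fintype.card_subtype]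
      congr 1
      ext j; simp
    rw [h1, Finset.card_sdiff_of_subset (Finset.subset_univ _),
      Finset.card_image_of_injective _ hJ]
    simp
  have ht : (Fintype.piFinset fun _ : O => X).card = X.card ^ M := by
    rw [Fintype.card_piFinset, Finset.prod_const, Finset.card_univ, hO]
  rw [← ht]
  refine Finset.card_le_mul_card_image_of_maps_to (f := fun z (j : O) => z j.1) ?_ _ ?_
  · intro z hz
    have hz' : ∀ j, z j ∈ X := by simpa using (Finset.mem_filter.1 hz).1
    simp [hz']
  · intro y _
    let Q : Fin c → Finset A := fun p => Finset.univ.image fun j => y j p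
    have hQ : ∀ p, (Q p).card ≤ M := fun p =>
      Finset.card_image_le.trans (by rw [Finset.card_univ, hO])
    refine le_trans ?_ (card_quadruples_le X Q M hQ)
    refine Finset.card_le_card_of_injOn (fun z k => z (J k)) ?_ ?_
    · intro z hz
      obtain ⟨hz1, hzy⟩ := Finset.mem_filter.1 hz
      obtain ⟨hzX, hzc⟩ := Finset.mem_filter.1 hz1
      have hz' : ∀ j, z j ∈ X := by simpa using hzX
      refine Finset.mem_filter.2 ⟨by simp [hz'], fun p a ha => hzc p a fun h => ha ?_⟩
      obtain ⟨j, hj, rfl⟩ := Finset.mem_image.1 h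
      refine Finset.mem_image.2 ⟨⟨j, (Finset.mem_filter.1 hj).2⟩, Finset.mem_univ _, ?_⟩
      rw [← hzy]
    · intro z hz z' hz' h
      have h1 := (Finset.mem_filter.1 hz).2
      have h2 := (Finset.mem_filter.1 hz').2
      funext j
      by_cases hj : ∀ k, J k ≠ j
      · have h3 := congrFun (h1.trans h2.symm) ⟨j, hj⟩
        exact h3
      · push Not at hj
        obtain ⟨k, rfl⟩ := hj
        exact congrFun h k

/-- The first and the second key of the `i`-th step and of the last step of a walk. -/
def fourIndices {w : ℕ} (i : Fin w) : Fin 4 → Fin (w + 2) :=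
  ![i.castSucc.castSucc, i.succ.castSucc, (Fin.last w).castSucc, Fin.last _]

omit [Fintype A] in
/-- If the last step of a closing walk is implied by the earlier ones, then its two keys and those
of some earlier step cancel outside of the characters of the other keys. -/
lemma IsClosing.exists_cancels {c w : ℕ} {z : Fin (w + 2) → Fin c → A} (hz : IsClosing z)
    (hspan : stepVec z (Fin.last w) ∈
      Submodule.span (ZMod 2) (Set.range fun i : Fin w => stepVec z i.castSucc)) :
    ∃ i : Fin w, (i : ℕ) + 2 ≤ w ∧ Cancels (fourIndices i) z := by
  obtain ⟨g, hg⟩ := (Submodule.mem_span_range_iff_exists_fun _).1 hspan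
  -- Only the steps of the same type as the last one matter.
  have hval : ∀ p a, ∑ i : Fin w, (if stepType i = stepType w then
      g i * (charVec (z i.castSucc.castSucc) (p, a) + charVec (z i.succ.castSucc) (p, a)) else 0) =
      charVec (z (Fin.last w).castSucc) (p, a) + charVec (z (Fin.last _)) (p, a) := by
    intro p a
    have := congrFun hg ((stepType w, p), a)
    simp only [Finset.sum_apply, Pi.smul_apply, smul_eq_mul, stepVec, linkVec, Fin.val_last,
      if_true, Fin.succ_last, Fin.succ_castSucc, Fin.val_castSucc] at this
    rw [← this]
    refine Finset.sum_congr rfl fun i _ => ?_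
    by_cases h : stepType i = stepType w
    · simp [h]
    · rw [if_neg h, if_neg (Ne.symm h), mul_zero]
  have hex : ∃ i : Fin w, stepType i = stepType w ∧ g i ≠ 0 := by
    by_contra! hno
    apply hz.ne
    funext p
    by_contra hp
    have h1 := hval p (z (Fin.last w).castSucc p)
    rw [Finset.sum_eq_zero] at h1
    · simp [charVec, Ne.symm hp] at h1
    · intro i _
      split_ifs with h
      · rw [hno i h, zero_mul]
      · rfl
  obtain ⟨i, hi, hgi⟩ := hex
  have hiw : (i : ℕ) + 2 ≤ w := by
    have := stepType_eq_iff.1 hi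
    omega
  refine ⟨i, hiw, fun p a ha => ?_⟩
  have hother : ∀ j : Fin (w + 2), (∀ k, fourIndices i k ≠ j) → charVec (z j) (p, a) = 0 := by
    intro j hj
    have : z j p ≠ a := fun h => ha (Finset.mem_image.2 ⟨j, by simpa using hj, h⟩)
    simp [charVec, this]
  have h1 := hval p a
  rw [Finset.sum_eq_single i] at h1
  · have hg1 : g i = 1 := by
      have : ∀ x : ZMod 2, x ≠ 0 → x = 1 := by decide
      exact this _ hgi
    rw [if_pos hi, hg1, one_mul] at h1
    rw [Fin.sum_univ_four]
    change charVec (z i.castSucc.castSucc) (p, a) + charVec (z i.succ.castSucc) (p, a) +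
      charVec (z (Fin.last w).castSucc) (p, a) + charVec (z (Fin.last _)) (p, a) = 0
    rw [add_assoc (_ + _), ← h1]
    exact CharTwo.add_self_eq_zero _
  · intro j _ hji
    have hji' : (j : ℕ) ≠ i := fun h => hji (Fin.ext h)
    by_cases h : stepType j = stepType w
    · have hp := stepType_eq_iff.1 h
      have hp' := stepType_eq_iff.1 hi
      have hj2 := j.2
      rw [if_pos h, hother, hother]
      · simp
      · intro k
        rw [Ne, Fin.ext_iff]
        fin_cases k <;> simp [fourIndices] <;> omega
      · intro k
        rw [Ne, Fin.ext_iff]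
        fin_cases k <;> simp [fourIndices] <;> omega
    · rw [if_neg h]
  · intro h
    exact absurd (Finset.mem_univ i) h

end Walks

/-! ### The expected size of the core -/

section CoreSize

variable {A : Type} [Fintype A] [DecidableEq A]

omit [Fintype A] in
open Classical in
lemma card_isClosing_le {c w : ℕ} (X : Finset (Fin c → A)) :
    ((Fintype.piFinset fun _ : Fin (w + 2) => X).filter fun z => IsClosing z).card ≤
      (w + 1) ^ c * X.card ^ (w + 1) := by
  have ht : (Fintype.piFinset fun _ : Fin (w + 1) => X).card = X.card ^ (w + 1) := by
    rw [Fintype.card_piFinset, Finset.prod_const, Finset.card_univ, Fintype.card_fin]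
  rw [← ht]
  refine Finset.card_le_mul_card_image_of_maps_to (f := fun z (j : Fin (w + 1)) => z j.castSucc)
    ?_ _ ?_
  · intro z hz
    have hz' : ∀ j, z j ∈ X := by simpa using (Finset.mem_filter.1 hz).1
    simp [hz']
  · intro y _
    have hcard : (Fintype.piFinset fun p : Fin c =>
        Finset.univ.image fun j : Fin (w + 1) => y j p).card ≤ (w + 1) ^ c := by
      rw [Fintype.card_piFinset]
      refine (Finset.prod_le_pow_card _ _ (w + 1) fun p _ => ?_).trans (by simp)
      exact Finset.card_image_le.trans (by simp)
    refine le_trans ?_ hcard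
    refine Finset.card_le_card_of_injOn (fun z => z (Fin.last _)) ?_ ?_
    · intro z hz
      obtain ⟨hz1, hzy⟩ := Finset.mem_filter.1 hz
      have hcl := (Finset.mem_filter.1 hz1).2
      refine Fintype.mem_piFinset.2 fun p => ?_
      obtain ⟨j, hj⟩ := hcl.covered p
      exact Finset.mem_image.2 ⟨j, Finset.mem_univ _, by rw [← hzy]; exact hj⟩
    · intro z hz z' hz' h
      have h1 := (Finset.mem_filter.1 hz).2
      have h2 := (Finset.mem_filter.1 hz').2
      funext j
      refine Fin.lastCases h (fun j => ?_) j
      exact congrFun (h1.trans h2.symm) j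

open Classical in
lemma card_isClosing_span_le {c w : ℕ} (X : Finset (Fin c → A)) :
    ((Fintype.piFinset fun _ : Fin (w + 2) => X).filter fun z => IsClosing z ∧
      stepVec z (Fin.last w) ∈
        Submodule.span (ZMod 2) (Set.range fun i : Fin w => stepVec z i.castSucc)).card ≤
      w * (3 * (1 + w) ^ 2) ^ c * X.card ^ w := by
  have hsub : ((Fintype.piFinset fun _ : Fin (w + 2) => X).filter fun z => IsClosing z ∧
      stepVec z (Fin.last w) ∈
        Submodule.span (ZMod 2) (Set.range fun i : Fin w => stepVec z i.castSucc)) ⊆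
      (Finset.univ.filter fun i : Fin w => (i : ℕ) + 2 ≤ w).biUnion fun i =>
        (Fintype.piFinset fun _ : Fin (w + 2) => X).filter (Cancels (fourIndices i)) := by
    intro z hz
    obtain ⟨hzX, hcl, hspan⟩ := Finset.mem_filter.1 hz
    obtain ⟨i, hi, h⟩ := hcl.exists_cancels hspan
    exact Finset.mem_biUnion.2 ⟨i, by simpa using hi, Finset.mem_filter.2 ⟨hzX, h⟩⟩
  refine (Finset.card_le_card hsub).trans (Finset.card_biUnion_le.trans ?_)
  have hle : ∀ i ∈ Finset.univ.filter fun i : Fin w => (i : ℕ) + 2 ≤ w,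
      ((Fintype.piFinset fun _ : Fin (w + 2) => X).filter (Cancels (fourIndices i))).card ≤
      (3 * (1 + w) ^ 2) ^ c * X.card ^ w := by
    intro i hi
    have hi' : (i : ℕ) + 2 ≤ w := by simpa using hi
    obtain ⟨M, rfl⟩ : ∃ M, w = M + 2 := ⟨w - 2, by omega⟩
    have hinj : Function.Injective (fourIndices i) := by
      intro a b hab
      rw [Fin.ext_iff] at hab
      fin_cases a <;> fin_cases b <;> simp [fourIndices] at hab ⊢ <;> omega
    refine (card_cancels_le (M := M) X (fourIndices i) hinj).trans ?_
    rw [mul_assoc, ← pow_add, add_comm 2 M]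
    gcongr
    omega
  refine (Finset.sum_le_card_nsmul _ _ _ hle).trans ?_
  rw [smul_eq_mul, mul_assoc]
  gcongr
  exact (Finset.card_le_univ _).trans (by simp)

open Classical in
/-- The expected number of closing walks with `w + 1` steps. -/
lemma sum_uniformProb_steps_le {c r w : ℕ} (X : Finset (Fin c → A)) :
    ∑ z ∈ (Fintype.piFinset fun _ : Fin (w + 2) => X).filter (fun z => IsClosing z),
      uniformProb {τ : PairPos c A → Bits r | ∀ i, tableSum (stepVec z i) τ = 0} ≤
      (w + 1 : ℝ) ^ c * ((X.card : ℝ) / 2 ^ r) ^ (w + 1) +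
        w * (3 * (1 + w : ℝ) ^ 2) ^ c * ((X.card : ℝ) / 2 ^ r) ^ w := by
  have hle : ∀ z ∈ (Fintype.piFinset fun _ : Fin (w + 2) => X).filter (fun z => IsClosing z),
      uniformProb {τ : PairPos c A → Bits r | ∀ i, tableSum (stepVec z i) τ = 0} ≤
      ((2 : ℝ) ^ r)⁻¹ ^ (w + 1) + if stepVec z (Fin.last w) ∈
        Submodule.span (ZMod 2) (Set.range fun i : Fin w => stepVec z i.castSucc) then
          ((2 : ℝ) ^ r)⁻¹ ^ w else 0 := by
    intro z hz
    have hcl := (Finset.mem_filter.1 hz).2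
    split_ifs with h
    · have := uniformProb_steps_le (r := r) hcl
      have h2 : 0 ≤ ((2 : ℝ) ^ r)⁻¹ ^ (w + 1) := by positivity
      linarith
    · rw [uniformProb_steps_eq hcl h, add_zero]
  refine (Finset.sum_le_sum hle).trans ?_
  rw [Finset.sum_add_distrib, ← Finset.sum_filter, Finset.filter_filter]
  simp only [Finset.sum_const, nsmul_eq_mul]
  have h1 : ((((Fintype.piFinset fun _ : Fin (w + 2) => X).filter
      fun z => IsClosing z).card : ℕ) : ℝ) ≤ (w + 1 : ℝ) ^ c * (X.card : ℝ) ^ (w + 1) := by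
    exact_mod_cast card_isClosing_le X
  have h2 := card_isClosing_span_le (w := w) X
  rw [← Nat.cast_le (α := ℝ)] at h2
  push_cast at h2
  rw [div_eq_mul_inv, mul_pow (X.card : ℝ), mul_pow (X.card : ℝ), ← mul_assoc, ← mul_assoc]
  gcongr

omit [Fintype A] [DecidableEq A] in
lemma exists_sum_closing_const (c : ℕ) (η : ℝ) (hη : 0 < η) :
    ∃ C : ℝ, 0 ≤ C ∧ ∀ (N : ℕ) (ρ : ℝ), 0 ≤ ρ → ρ ≤ 1 / (1 + η) →
      ∑ w ∈ Finset.range N, ((w + 1 : ℝ) ^ c * ρ ^ (w + 1) +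
        w * (3 * (1 + w : ℝ) ^ 2) ^ c * ρ ^ w) ≤ C * ρ := by
  set ρ₀ := 1 / (1 + η) with hρ₀
  have hρ0 : 0 < ρ₀ := by positivity
  have hρ1 : ρ₀ < 1 := by rw [hρ₀, div_lt_one (by positivity)]; linarith
  set D := 1 + 3 ^ c * (1 + η) with hD
  have hsum : Summable fun w : ℕ => ((w : ℝ) + 1) ^ (2 * c + 1) * ρ₀ ^ w := by
    have h1 := summable_pow_mul_geometric_of_norm_lt_one (2 * c + 1)
      (show ‖ρ₀‖ < 1 by rwa [Real.norm_of_nonneg hρ0.le])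
    have h2 := ((summable_nat_add_iff 1).2 h1).mul_right ρ₀⁻¹
    refine h2.congr fun w => ?_
    push_cast
    rw [pow_succ ρ₀]; field_simp
  refine ⟨D * ∑' w : ℕ, ((w : ℝ) + 1) ^ (2 * c + 1) * ρ₀ ^ w, by positivity, ?_⟩
  intro N ρ h0 hle
  have hterm : ∀ w : ℕ, (w + 1 : ℝ) ^ c * ρ ^ (w + 1) +
        w * (3 * (1 + w : ℝ) ^ 2) ^ c * ρ ^ w ≤
        ρ * D * (((w : ℝ) + 1) ^ (2 * c + 1) * ρ₀ ^ w) := by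
    intro w
    have ha : (w + 1 : ℝ) ^ c * ρ ^ (w + 1) ≤ ρ * (((w : ℝ) + 1) ^ (2 * c + 1) * ρ₀ ^ w) := by
      calc (w + 1 : ℝ) ^ c * ρ ^ (w + 1) = ρ * ((w + 1 : ℝ) ^ c * ρ ^ w) := by ring
        _ ≤ _ := by
          gcongr
          · linarith [show (0 : ℝ) ≤ w by positivity]
          · omega
    have hb : w * (3 * (1 + w : ℝ) ^ 2) ^ c * ρ ^ w ≤
        ρ * (3 ^ c * (1 + η)) * (((w : ℝ) + 1) ^ (2 * c + 1) * ρ₀ ^ w) := by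
      rcases w with _ | w
      · simp only [Nat.cast_zero, zero_mul]; positivity
      · have e : ρ₀ * (1 + η) = 1 := by rw [hρ₀]; field_simp
        calc ((w + 1 : ℕ) : ℝ) * (3 * (1 + ((w + 1 : ℕ) : ℝ)) ^ 2) ^ c * ρ ^ (w + 1)
            = ρ * 3 ^ c * (((w + 1 : ℕ) : ℝ) * (((w + 1 : ℕ) : ℝ) + 1) ^ (2 * c) * ρ ^ w) := by
              rw [mul_pow, ← pow_mul]; ring
          _ ≤ ρ * 3 ^ c * ((((w + 1 : ℕ) : ℝ) + 1) * (((w + 1 : ℕ) : ℝ) + 1) ^ (2 * c) *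
                ρ₀ ^ w) := by
              gcongr
              linarith
          _ = ρ * 3 ^ c * ((((w + 1 : ℕ) : ℝ) + 1) ^ (2 * c + 1) * (ρ₀ ^ w * (ρ₀ * (1 + η)))) := by
              rw [e]; ring
          _ = _ := by ring
    calc _ ≤ _ := add_le_add ha hb
      _ = _ := by rw [hD]; ring
  refine (Finset.sum_le_sum fun w _ => hterm w).trans ?_
  rw [← Finset.mul_sum]
  have := hsum.sum_le_tsum (Finset.range N) fun w _ => by positivity
  calc _ ≤ ρ * D * ∑' w : ℕ, ((w : ℝ) + 1) ^ (2 * c + 1) * ρ₀ ^ w := by gcongr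
    _ = _ := by ring

/-- The expected number of keys in the core of a pair of simple tabulation functions with values
in `[2 ^ r]` on `n` keys is at most the sum of the expected numbers of closing walks. -/
lemma sum_uniformProb_inCore_le {c r : ℕ} (hc : 0 < c) (X : Finset (Fin c → A)) :
    ∑ x ∈ X, uniformProb {τ : PairPos c A → Bits r | InCore X τ x} ≤
      ∑ w ∈ Finset.range X.card, ((w + 1 : ℝ) ^ c * ((X.card : ℝ) / 2 ^ r) ^ (w + 1) +
        w * (3 * (1 + w : ℝ) ^ 2) ^ c * ((X.card : ℝ) / 2 ^ r) ^ w) := by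
  classical
  let Z : (w : ℕ) → Finset (Fin (w + 2) → Fin c → A) := fun w =>
    (Fintype.piFinset fun _ : Fin (w + 2) => X).filter fun z => IsClosing z
  have hx : ∀ x ∈ X, uniformProb {τ : PairPos c A → Bits r | InCore X τ x} ≤
      ∑ w ∈ Finset.range X.card, ∑ z ∈ (Z w).filter (fun z => z 0 = x),
        uniformProb {τ : PairPos c A → Bits r | ∀ i, tableSum (stepVec z i) τ = 0} := by
    intro x _
    have hsub : {τ : PairPos c A → Bits r | InCore X τ x} ⊆
        ⋃ w ∈ Finset.range X.card, ⋃ z ∈ (Z w).filter (fun z => z 0 = x),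
          {τ : PairPos c A → Bits r | ∀ i, tableSum (stepVec z i) τ = 0} := by
      intro τ hτ
      obtain ⟨w, z, hzX, hz, hz0, hstep⟩ := InCore.exists_closing hc hτ
      refine Set.mem_biUnion (x := w) (by simpa using hz.lt_card hzX) ?_
      refine Set.mem_biUnion (x := z) ?_ hstep
      simp [Z, hzX, hz, hz0]
    refine (uniformProb_mono hsub).trans ((uniformProb_biUnion_le _ _).trans ?_)
    exact Finset.sum_le_sum fun w _ => uniformProb_biUnion_le _ _
  refine (Finset.sum_le_sum hx).trans ?_
  rw [Finset.sum_comm]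
  refine Finset.sum_le_sum fun w _ => ?_
  rw [Finset.sum_fiberwise_of_maps_to]
  · exact sum_uniformProb_steps_le X
  · intro z hz
    have : ∀ j, z j ∈ X := by simpa using (Finset.mem_filter.1 hz).1
    exact this 0

/-- Some nonempty subset of `X` has no key with a unique value under any of the functions given by
the `D` pairs of tables `τ`. -/
def HasCommonCore {c r D : ℕ} (X : Finset (Fin c → A)) (τ : Fin D → PairPos c A → Bits r) : Prop :=
  ∃ Y ⊆ X, Y.Nonempty ∧
    ∀ k, ∀ y ∈ Y, ∀ t, ∃ y' ∈ Y, y' ≠ y ∧ simpleTab (τ k) t y' = simpleTab (τ k) t y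

/-- A common core is unlikely. Some key `x` of `X` is in the core of `X` with at most the average
probability `C / 2 ^ r`, hence in the cores of all `D` pairs with probability at most
`(C / 2 ^ r) ^ D`; a common core that avoids `x` is a common core of the other keys. -/
lemma uniformProb_hasCommonCore_le (c : ℕ) (hc : 0 < c) (η : ℝ) (hη : 0 < η) :
    ∃ C : ℝ, 0 ≤ C ∧ ∀ (A : Type) [Fintype A] [DecidableEq A] (r D : ℕ) (X : Finset (Fin c → A)),
      (X.card : ℝ) ≤ 2 ^ r / (1 + η) →
      uniformProb {τ : Fin D → PairPos c A → Bits r | HasCommonCore X τ} ≤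
        X.card * (C / 2 ^ r) ^ D := by
  obtain ⟨C, hC0, hC⟩ := exists_sum_closing_const c η hη
  refine ⟨C, hC0, fun A _ _ r D X => ?_⟩
  induction X using Finset.strongInduction with
  | H X ih =>
    intro hX
    have hs : (0 : ℝ) < 2 ^ r := by positivity
    rcases X.eq_empty_or_nonempty with rfl | hne
    · have : {τ : Fin D → PairPos c A → Bits r | HasCommonCore ∅ τ} = ∅ := by
        ext τ
        simp only [Set.mem_ofPred_eq, Set.mem_empty_iff_false, iff_false]
        rintro ⟨Y, hY, hne, -⟩
        exact hne.ne_empty (Finset.subset_empty.1 hY)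
      simp [this, uniformProb_empty]
    · have hρ : (X.card : ℝ) / 2 ^ r ≤ 1 / (1 + η) := by
        rw [div_le_iff₀ hs]
        calc (X.card : ℝ) ≤ _ := hX
          _ = _ := by ring
      have hsum := (sum_uniformProb_inCore_le (r := r) hc X).trans
        (hC X.card _ (by positivity) hρ)
      obtain ⟨x, hxX, hx⟩ := Finset.exists_le_of_sum_le (s := X)
        (f := fun x => uniformProb {τ : PairPos c A → Bits r | InCore X τ x})
        (g := fun _ => C / 2 ^ r) hne (by
          rw [Finset.sum_const, nsmul_eq_mul]
          refine hsum.trans (le_of_eq (by ring)))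
      have hsub : {τ : Fin D → PairPos c A → Bits r | HasCommonCore X τ} ⊆
          {τ | ∀ k, τ k ∈ {τ : PairPos c A → Bits r | InCore X τ x}} ∪
          {τ | HasCommonCore (X.erase x) τ} := by
        rintro τ ⟨Y, hYX, hYne, hY⟩
        by_cases hxY : x ∈ Y
        · exact Or.inl fun k => ⟨Y, hYX, hxY, hY k⟩
        · exact Or.inr ⟨Y, Finset.subset_erase.2 ⟨hYX, hxY⟩, hYne, hY⟩
      have hcard : ((X.erase x).card : ℝ) = X.card - 1 := by
        rw [Finset.card_erase_of_mem hxX, Nat.cast_pred (Finset.card_pos.2 hne)]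
      have h1 := ih (X.erase x) (Finset.erase_ssubset hxX) (by rw [hcard]; linarith)
      rw [hcard] at h1
      have h2 : uniformProb {τ : Fin D → PairPos c A → Bits r |
          ∀ k, τ k ∈ {τ : PairPos c A → Bits r | InCore X τ x}} ≤ (C / 2 ^ r) ^ D := by
        rw [uniformProb_pi (E := fun _ : Fin D => {τ : PairPos c A → Bits r | InCore X τ x}),
          Finset.prod_const, Finset.card_univ, Fintype.card_fin]
        gcongr
        exact uniformProb_nonneg _
      calc _ ≤ _ := uniformProb_mono hsub
        _ ≤ _ := uniformProb_union_le _ _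
        _ ≤ (C / 2 ^ r) ^ D + (X.card - 1) * (C / 2 ^ r) ^ D := add_le_add h2 h1
        _ = _ := by ring

end CoreSize

/-! ### Mixed tabulation is uniform on small sets of keys -/

section MixedTabulation

/-- The key `x` as a list of `c` characters. -/
def keyChars (c b x : ℕ) : Fin c → Bits b := fun i => keyChar b x i

lemma keyChars_injOn {c b x y : ℕ} (hx : x < 2 ^ (c * b)) (hy : y < 2 ^ (c * b))
    (h : keyChars c b x = keyChars c b y) : x = y := by
  apply Nat.eq_of_testBit_eq
  intro t
  by_cases ht : t < c * b
  · have hb : 0 < b := Nat.pos_of_ne_zero (by rintro rfl; simp at ht)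
    have hq : t / b < c := Nat.div_lt_of_lt_mul (by rwa [mul_comm] at ht)
    have h1 := congrFun (congrFun h ⟨t / b, hq⟩) ⟨t % b, Nat.mod_lt _ hb⟩
    simp only [keyChars, keyChar, Nat.div_add_mod'] at h1
    cases hx' : x.testBit t <;> cases hy' : y.testBit t <;> simp_all
  · have hle : 2 ^ (c * b) ≤ 2 ^ t := Nat.pow_le_pow_right (by norm_num) (by omega)
    rw [Nat.testBit_eq_false_of_lt (hx.trans_le hle), Nat.testBit_eq_false_of_lt (hy.trans_le hle)]

/-- The derived characters of the key `x` under the tables `T₁`. -/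
def derivedOf {c d b : ℕ} (T₁ : Fin c → Bits b → Fin d → Bits b) (x : ℕ) : Fin d → Bits b :=
  ∑ i, T₁ i (keyChars c b x i)

/-- The input and the derived characters of the key `x`. -/
def extendedKey {c d b : ℕ} (T₁ : Fin c → Bits b → Fin d → Bits b) (x : ℕ) :
    Fin (c + d) → Bits b :=
  Fin.append (keyChars c b x) (derivedOf T₁ x)

lemma mixedTabulation_eq_tableSum {c d b r : ℕ} (T : MixedTables c d b r) (x : ℕ) :
    mixedTabulation T x =
      tableSum (charVec (extendedKey T.1 x)) fun p : Fin (c + d) × Bits b => T.2 p.1 p.2 := by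
  rw [tableSum_charVec, Fin.sum_univ_add]
  simp only [extendedKey, Fin.append_left, Fin.append_right]
  rfl

/-- The tables `T₁` of the derived characters, grouped into pairs of derived characters. -/
def pairTables {c d b : ℕ} (T₁ : Fin c → Bits b → Fin d → Bits b) :
    Fin (d / 2) → PairPos c (Bits b) → Bits b :=
  fun k p => T₁ p.1.2 p.2 ⟨2 * k + p.1.1, by omega⟩

lemma simpleTab_pairTables {c d b : ℕ} (T₁ : Fin c → Bits b → Fin d → Bits b) (k : Fin (d / 2))
    (t : Fin 2) (x : ℕ) :
    simpleTab (pairTables T₁ k) t (keyChars c b x) = derivedOf T₁ x ⟨2 * k + t, by omega⟩ := by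
  simp [simpleTab, pairTables, derivedOf, Finset.sum_apply]

lemma pairTables_surjective {c d b : ℕ} :
    Function.Surjective (pairTables : (Fin c → Bits b → Fin d → Bits b) → _) := by
  intro τ
  refine ⟨fun i a e => if h : (e : ℕ) / 2 < d / 2 then
    τ ⟨e / 2, h⟩ ((⟨e % 2, Nat.mod_lt _ (by norm_num)⟩, i), a) else 0, ?_⟩
  funext k p
  obtain ⟨⟨t, i⟩, a⟩ := p
  have h1 : (2 * (k : ℕ) + t) / 2 = k := by omega
  have h2 : (2 * (k : ℕ) + t) % 2 = t := by omega
  simp only [pairTables, h1, h2, k.2, dif_pos]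

lemma uniformProb_pairTables {c d b : ℕ} (E : Set (Fin (d / 2) → PairPos c (Bits b) → Bits b)) :
    uniformProb {T₁ : Fin c → Bits b → Fin d → Bits b | pairTables T₁ ∈ E} = uniformProb E :=
  uniformProb_preimage_of_surjective pairTables (fun _ _ => rfl) pairTables_surjective E

/-- If the derived characters of the keys have no common core, then the extended keys are linearly
independent: in a vanishing combination, every derived character occurs an even number of times,
hence at least twice. -/
lemma linearIndependent_extendedKey {c d b : ℕ} {κ : Type} [Fintype κ] (key : κ → ℕ)
    (hkey : Function.Injective fun j => keyChars c b (key j))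
    (T₁ : Fin c → Bits b → Fin d → Bits b)
    (hT : ¬ HasCommonCore (Finset.univ.image fun j => keyChars c b (key j)) (pairTables T₁)) :
    LinearIndependent (ZMod 2) fun j => charVec (extendedKey T₁ (key j)) := by
  classical
  rw [Fintype.linearIndependent_iff]
  intro g hg
  by_contra! hne
  obtain ⟨j₀, hj₀⟩ := hne
  refine hT ⟨(Finset.univ.filter fun j => g j ≠ 0).image fun j => keyChars c b (key j),
    Finset.image_subset_image (Finset.filter_subset _ _),
    ⟨_, Finset.mem_image_of_mem _ (by simpa using hj₀)⟩, ?_⟩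
  intro k y hy t
  obtain ⟨j, hj, rfl⟩ := Finset.mem_image.1 hy
  have hgj : g j ≠ 0 := by simpa using hj
  by_contra! hno
  set e : Fin d := ⟨2 * k + t, by omega⟩ with he
  have h1 := congrFun hg (Fin.natAdd c e, derivedOf T₁ (key j) e)
  simp only [Finset.sum_apply, Pi.smul_apply, smul_eq_mul, charVec, extendedKey,
    Fin.append_right, Pi.zero_apply] at h1
  rw [Finset.sum_eq_single j] at h1
  · exact hgj (by simpa using h1)
  · intro i _ hij
    by_cases hgi : g i = 0
    · rw [hgi, zero_mul]
    · have h2 := hno (keyChars c b (key i)) (Finset.mem_image_of_mem _ (by simpa using hgi))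
        (fun h => hij (hkey h))
      rw [simpleTab_pairTables, simpleTab_pairTables] at h2
      rw [if_neg h2, mul_zero]
  · intro h
    exact absurd (Finset.mem_univ j) h

lemma mixedTabulation_surjective {c d b r : ℕ} {κ : Type} [Fintype κ] (key : κ → ℕ)
    (hkey : Function.Injective fun j => keyChars c b (key j))
    (T₁ : Fin c → Bits b → Fin d → Bits b)
    (hT : ¬ HasCommonCore (Finset.univ.image fun j => keyChars c b (key j)) (pairTables T₁)) :
    Function.Surjective fun (T₂ : Fin (c + d) → Bits b → Bits r) j =>
      mixedTabulation (T₁, T₂) (key j) := by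
  intro y
  obtain ⟨τ, hτ⟩ := tableSum_surjective (linearIndependent_extendedKey key hkey T₁ hT) y
  refine ⟨fun p a => τ (p, a), ?_⟩
  rw [← hτ]
  funext j
  exact mixedTabulation_eq_tableSum _ _

lemma mixedTabulation_add {c d b r : ℕ} (T₁ : Fin c → Bits b → Fin d → Bits b)
    (T₂ T₂' : Fin (c + d) → Bits b → Bits r) (x : ℕ) :
    mixedTabulation (T₁, T₂ + T₂') x =
      mixedTabulation (T₁, T₂) x + mixedTabulation (T₁, T₂') x := by
  simp only [mixedTabulation_eq_tableSum]
  exact tableSum_add _ _ _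

end MixedTabulation

/-! ### Feature hashing with mixed tabulation -/

section FeatureHashing

lemma norm_sq_featureHash {n : ℕ} {β : Type} [Fintype β] [DecidableEq β] (h : Fin n → β)
    (z : Fin n → ZMod 2) (v : EuclideanSpace ℝ (Fin n)) :
    ‖featureHash h (fun j => bitSign (z j)) v‖ ^ 2 =
      ∑ i, bucketSums (fun j : {j // v j ≠ 0} => v j) (fun j => (h j, z j)) 0 i ^ 2 := by
  classical
  rw [EuclideanSpace.norm_sq_eq]
  refine Finset.sum_congr rfl fun i _ => ?_
  rw [Real.norm_eq_abs, sq_abs]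
  congr 1
  simp only [featureHash, bucketSums, Pi.zero_apply, zero_add, signVal]
  rw [Finset.sum_filter, ← Finset.sum_subtype (Finset.univ.filter fun j => v j ≠ 0) (by simp)
    (fun j => if h j = i then ((bitSign (z j) : ℤ) : ℝ) * v j else 0)]
  rw [Finset.sum_filter_of_ne]
  intro j _ hj hv
  simp [hv] at hj

/-- Bucket and sign of a hash value: the first bit is the sign, the other bits the bucket. -/
def splitBits {l : ℕ} (y : Bits (l + 1)) : Bits l × ZMod 2 := (Fin.tail y, y 0)

lemma splitBits_surjective {l : ℕ} : Function.Surjective (splitBits (l := l)) :=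
  fun p => ⟨Fin.cons p.2 p.1, by simp [splitBits]⟩

variable {c d b l n : ℕ}

lemma uniformProb_fhOne_le (v : EuclideanSpace ℝ (Fin n)) (E : Set ℝ) (p q : ℝ) (hq : 0 ≤ q)
    (hkey : Function.Injective fun j : {j // v j ≠ 0} => keyChars c b j)
    (hT : uniformProb {T₁ : Fin c → Bits b → Fin d → Bits b |
      HasCommonCore (Finset.univ.image fun j : {j // v j ≠ 0} => keyChars c b j)
        (pairTables T₁)} ≤ p)
    (hE : uniformProb {ω : {j // v j ≠ 0} → Bits l × ZMod 2 |
      ∑ i, bucketSums (fun j : {j // v j ≠ 0} => v j) ω 0 i ^ 2 ∈ E} ≤ q) :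
    uniformProb {T : MixedTables c d b (l + 1) | ‖fhOne T v‖ ^ 2 ∈ E} ≤ p + q := by
  classical
  refine (uniformProb_prod_le _ {T₁ | HasCommonCore (Finset.univ.image
    fun j : {j // v j ≠ 0} => keyChars c b j) (pairTables T₁)} q hq ?_).trans (by gcongr)
  intro T₁ hT₁
  refine le_trans (le_of_eq ?_) hE
  rw [← uniformProb_preimage_of_surjective
    (fun (T₂ : Fin (c + d) → Bits b → Bits (l + 1)) (j : {j // v j ≠ 0}) =>
      splitBits (mixedTabulation (T₁, T₂) j))]
  · congr 1
    ext T₂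
    simp only [Set.mem_ofPred_eq, Set.mem_preimage, fhOne]
    rw [norm_sq_featureHash]
    rfl
  · intro T₂ T₂'
    funext j
    simp only [mixedTabulation_add, Pi.add_apply]
    rfl
  · exact splitBits_surjective.comp_left.comp
      (mixedTabulation_surjective (fun j : {j // v j ≠ 0} => (j : ℕ)) hkey T₁ hT₁)

lemma uniformProb_fhTwo_le (v : EuclideanSpace ℝ (Fin n)) (E : Set ℝ) (p q : ℝ) (hq : 0 ≤ q)
    (hkey : Function.Injective fun j : {j // v j ≠ 0} => keyChars c b j)
    (hT : uniformProb {T₁ : Fin c → Bits b → Fin d → Bits b |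
      HasCommonCore (Finset.univ.image fun j : {j // v j ≠ 0} => keyChars c b j)
        (pairTables T₁)} ≤ p)
    (hE : uniformProb {ω : {j // v j ≠ 0} → Bits l × ZMod 2 |
      ∑ i, bucketSums (fun j : {j // v j ≠ 0} => v j) ω 0 i ^ 2 ∈ E} ≤ q) :
    uniformProb {T : MixedTables c d b l × MixedTables c d b 1 | ‖fhTwo T.1 T.2 v‖ ^ 2 ∈ E} ≤
      2 * p + q := by
  classical
  set F : Set (Fin c → Bits b → Fin d → Bits b) := {T₁ | HasCommonCore (Finset.univ.image
    fun j : {j // v j ≠ 0} => keyChars c b j) (pairTables T₁)} with hF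
  rw [← uniformProb_preimage_equiv (Equiv.prodProdProdComm (Fin c → Bits b → Fin d → Bits b)
    (Fin c → Bits b → Fin d → Bits b) (Fin (c + d) → Bits b → Bits l)
    (Fin (c + d) → Bits b → Bits 1))]
  have hF2 : uniformProb (Prod.fst ⁻¹' F ∪ Prod.snd ⁻¹' F) ≤ 2 * p := by
    refine (uniformProb_union_le _ _).trans ?_
    rw [uniformProb_preimage_of_surjective (Prod.fst :
        (Fin c → Bits b → Fin d → Bits b) × (Fin c → Bits b → Fin d → Bits b) → _)
        (fun _ _ => rfl) Prod.fst_surjective,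
      uniformProb_preimage_of_surjective (Prod.snd :
        (Fin c → Bits b → Fin d → Bits b) × (Fin c → Bits b → Fin d → Bits b) → _)
        (fun _ _ => rfl) Prod.snd_surjective]
    linarith
  refine (uniformProb_prod_le _ (Prod.fst ⁻¹' F ∪ Prod.snd ⁻¹' F) q hq ?_).trans (by gcongr)
  rintro ⟨T₁, S₁⟩ hT₁
  obtain ⟨hT₁, hS₁⟩ := not_or.1 hT₁
  refine le_trans (le_of_eq ?_) hE
  rw [← uniformProb_preimage_of_surjective
    (fun (T₂ : (Fin (c + d) → Bits b → Bits l) × (Fin (c + d) → Bits b → Bits 1))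
      (j : {j // v j ≠ 0}) => (mixedTabulation (T₁, T₂.1) j, mixedTabulation (S₁, T₂.2) j 0))]
  · congr 1
    ext T₂
    simp only [Set.mem_ofPred_eq, Set.mem_preimage, fhTwo, Equiv.prodProdProdComm_apply]
    rw [norm_sq_featureHash]
  · intro T₂ T₂'
    funext j
    simp only [mixedTabulation_add, Pi.add_apply, Prod.fst_add, Prod.snd_add]
    rfl
  · intro y
    obtain ⟨T₂, hT₂⟩ := mixedTabulation_surjective (r := l)
      (fun j : {j // v j ≠ 0} => (j : ℕ)) hkey T₁ hT₁ fun j => (y j).1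
    obtain ⟨S₂, hS₂⟩ := mixedTabulation_surjective (r := 1)
      (fun j : {j // v j ≠ 0} => (j : ℕ)) hkey S₁ hS₁ fun j _ => (y j).2
    refine ⟨(T₂, S₂), ?_⟩
    funext j
    exact Prod.ext (congrFun hT₂ j) (congrFun (congrFun hS₂ j) 0)

end FeatureHashing

theorem corollary2 (c d : ℕ) (hc : 0 < c) (η : ℝ) (hη : 0 < η) :
    ∃ C : ℝ, 0 < C ∧
      ∀ (b l n : ℕ), n ≤ 2 ^ (c * b) →
      ∀ (v : EuclideanSpace ℝ (Fin n)) (ε δ : ℝ),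
        0 < ε → ε < 1 → 0 < δ → δ < 1 →
        ‖v‖ = 1 →
        16 * ε⁻¹ ^ 2 * Real.logb 2 (1 / δ) ≤ (2 : ℝ) ^ l →
        (∀ j, |v j| ≤ √(ε * Real.log (1 + 4 / ε)) /
          (6 * √(Real.log (1 / δ) * Real.log ((2 : ℝ) ^ l / δ)))) →
        ((Finset.univ.filter fun j => v j ≠ 0).card : ℝ) ≤ (2 : ℝ) ^ b / (1 + η) →
        1 - 4 * δ - C * ((2 : ℝ) ^ b) ^ (1 - ((d / 2 : ℕ) : ℤ)) ≤
            uniformProb {T : MixedTables c d b l × MixedTables c d b 1 |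
              1 - ε < ‖fhTwo T.1 T.2 v‖ ^ 2 ∧ ‖fhTwo T.1 T.2 v‖ ^ 2 < 1 + ε} ∧
        1 - 4 * δ - C * ((2 : ℝ) ^ b) ^ (1 - ((d / 2 : ℕ) : ℤ)) ≤
            uniformProb {T : MixedTables c d b (l + 1) |
              1 - ε < ‖fhOne T v‖ ^ 2 ∧ ‖fhOne T v‖ ^ 2 < 1 + ε} := by
  obtain ⟨C₀, hC₀, hcore⟩ := uniformProb_hasCommonCore_le c hc η hη
  refine ⟨2 * C₀ ^ (d / 2) + 1, by positivity, ?_⟩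
  intro b l n hn v ε δ hε hε1 hδ hδ1 hv hm hva hsupp
  classical
  set s : ℝ := (2 : ℝ) ^ b with hs
  have hs0 : 0 < s := by positivity
  set R : ℝ := s ^ (1 - ((d / 2 : ℕ) : ℤ)) with hR
  have hR0 : 0 < R := by positivity
  by_cases hδ4 : 1 / 4 ≤ δ
  · have h0 : 1 - 4 * δ - (2 * C₀ ^ (d / 2) + 1) * R ≤ 0 := by
      have : 0 ≤ (2 * C₀ ^ (d / 2) + 1) * R := by positivity
      linarith
    exact ⟨h0.trans (uniformProb_nonneg _), h0.trans (uniformProb_nonneg _)⟩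
  push Not at hδ4
  have hkey : Function.Injective fun j : {j // v j ≠ 0} => keyChars c b j := by
    intro i j hij
    have := keyChars_injOn (i.1.2.trans_le hn) (j.1.2.trans_le hn) hij
    exact Subtype.ext (Fin.ext this)
  have hcard : ((Finset.univ.image fun j : {j // v j ≠ 0} => keyChars c b j).card : ℝ) ≤
      s / (1 + η) := by
    rw [Finset.card_image_of_injective _ hkey, Finset.card_univ, Fintype.card_subtype]
    exact hsupp
  have hbad : uniformProb {T₁ : Fin c → Bits b → Fin d → Bits b |
      HasCommonCore (Finset.univ.image fun j : {j // v j ≠ 0} => keyChars c b j)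
        (pairTables T₁)} ≤ C₀ ^ (d / 2) * R := by
    have h1 := uniformProb_pairTables (c := c) (d := d) (b := b)
      {τ | HasCommonCore (Finset.univ.image fun j : {j // v j ≠ 0} => keyChars c b j) τ}
    simp only [Set.mem_ofPred_eq] at h1
    rw [h1]
    refine (hcore (Bits b) b (d / 2) _ hcard).trans ?_
    have h2 : ((Finset.univ.image fun j : {j // v j ≠ 0} => keyChars c b j).card : ℝ) ≤ s :=
      hcard.trans (div_le_self hs0.le (by linarith))
    calc _ ≤ s * (C₀ / s) ^ (d / 2) := by gcongr
      _ = C₀ ^ (d / 2) * R := by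
        rw [hR, zpow_sub₀ hs0.ne', zpow_one, zpow_natCast, div_pow]
        ring
  have hnorm : ∑ j : {j // v j ≠ 0}, v j ^ 2 = 1 := by
    have h1 : ∑ j, v j ^ 2 = 1 := by
      have := EuclideanSpace.norm_sq_eq v
      rw [hv] at this
      simpa using this.symm
    rw [← h1, ← Finset.sum_subtype (Finset.univ.filter fun j => v j ≠ 0) (by simp)
      (fun j => v j ^ 2), Finset.sum_filter_of_ne]
    intro j _ hj h0
    simp [h0] at hj
  have hcardB : (Fintype.card (Bits l) : ℝ) = 2 ^ l := by simp
  have hrand := uniformProb_featureHashing_le (β := Bits l) (fun j : {j // v j ≠ 0} => v j) ε δ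
    hε hε1 hδ hδ4 hnorm (by rw [hcardB]; exact hm) (by rw [hcardB]; exact fun j => hva j)
  have h2 := uniformProb_fhTwo_le v {x | ¬ (1 - ε < x ∧ x < 1 + ε)} _ (4 * δ) (by positivity)
    hkey hbad hrand
  have h1 := uniformProb_fhOne_le v {x | ¬ (1 - ε < x ∧ x < 1 + ε)} _ (4 * δ) (by positivity)
    hkey hbad hrand
  have hCR : 0 ≤ C₀ ^ (d / 2) * R := by positivity
  constructor
  · have h3 := uniformProb_compl {T : MixedTables c d b l × MixedTables c d b 1 |
      1 - ε < ‖fhTwo T.1 T.2 v‖ ^ 2 ∧ ‖fhTwo T.1 T.2 v‖ ^ 2 < 1 + ε}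
    have h4 := h3.symm.trans_le h2
    linarith
  · have h3 := uniformProb_compl {T : MixedTables c d b (l + 1) |
      1 - ε < ‖fhOne T v‖ ^ 2 ∧ ‖fhOne T v‖ ^ 2 < 1 + ε}
    have h4 := h3.symm.trans_le h1
    linarith
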